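/- For a complex polynomial $p$ of degree $d\ge 1$, let its empirical measure be the probability measure on $\mathbf C$ with an atom of mass $m/d$ at every zero of $p$ of multiplicity $m$. For every $n\ge 1$ let $P_n$ be a complex polynomial of degree exactly $n$, let $\mu_n$ be its empirical measure and, for $n\ge2$, let $\mu_n'$ be the empirical measure of $P_n'$, i.e. of the critical points of $P_n$ counted with multiplicity. Let $\mu$ be a locally finite Borel measure on $\mathbf C$ such that the complement of its closed support has no bounded connected components. (a) If $\mu\neq 0$ and $\mu_n\to\mu$ weakly in the sense that $\int f\,d\mu_n\to\int f\,d\mu$ for every continuous $f:\mathbf C\to\mathbf R$ with compact support, then $\mu_n'\to\mu$ in the same sense. (b) If $\mu_n\to\mu$ weakly in the sense that $\int f\,d\mu_n\to\int f\,d\mu$ for every bounded continuous $f:\mathbf C\to\mathbf R$, then $\mu_n'\to\mu$ in the same sense. -/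

import Mathlib

open MeasureTheory Filter Topology Polynomial
open scoped ENNReal BoundedContinuousFunction

/-- The empirical measure of a complex polynomial `p` of degree `d ≥ 1`: mass `m / d` at each
zero of multiplicity `m` (`p.roots` lists the zeros with multiplicity). It is the zero measure
when `p` is constant. -/
noncomputable def empiricalMeasure (p : ℂ[X]) : Measure ℂ :=
  ((p.natDegree : ℝ≥0∞)⁻¹) • (p.roots.map fun z => Measure.dirac z).sum

/-- Weak convergence tested against compactly supported continuous functions
(mass may escape to infinity). -/
def VagueTendsto (ν : ℕ → Measure ℂ) (μ : Measure ℂ) : Prop :=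
  ∀ f : ℂ → ℝ, Continuous f → HasCompactSupport f →
    Tendsto (fun n => ∫ z, f z ∂(ν n)) atTop (𝓝 (∫ z, f z ∂μ))

/-- Weak convergence tested against bounded continuous functions. -/
def WeakTendsto (ν : ℕ → Measure ℂ) (μ : Measure ℂ) : Prop :=
  ∀ f : ℂ →ᵇ ℝ, Tendsto (fun n => ∫ z, f z ∂(ν n)) atTop (𝓝 (∫ z, f z ∂μ))

/-- The open set `U` has no bounded connected component. -/
def NoBoundedComponent (U : Set ℂ) : Prop :=
  ∀ z ∈ U, ¬ Bornology.IsBounded (connectedComponentIn U z)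

open scoped ContDiff

/-! Write U_ν for the logarithmic potential and C_ν for the Cauchy transform of ν. For the empirical
measure of P_n the Cauchy transform is P_n'/(n P_n), so log|C_{μ_n}| = (n-1) U_{μ_n'} - n U_{μ_n} +
const almost everywhere (`exists_log_norm_cauchyTransform_empiricalMeasure`). The kernel of U is
normalised to vanish as w → ∞, so vague convergence, even with loss of mass, gives convergence in
measure of U and C.

Let μ' be a vague limit of a subsequence of μ_n'. Dividing by n along a further subsequence yields a
constant c with U_{μ'} + c ≤ U_μ almost everywhere, and with equality almost everywhere where C_μ ≠
0.

Equality holds on the rest too (`eq_of_log_norm_cauchyTransform`). Suppose U_{μ'}(x) + c < t <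
U_μ(x) at a typical x. By upper semicontinuity U_{μ'} + c < t near x, so C_μ = 0 almost everywhere
near x on {U_μ > t}. Since C_μ encodes the gradient of U_μ, the truncation max(U_μ, t) is constant
near x (`exists_ae_max_logPotential_eq`), with a value above t because {U_μ > t} has positive
measure near x. Hence U_μ is constant near x and x is off the support of μ. But there C_μ ≠ 0 almost
everywhere (`ae_cauchyTransform_ne_zero`): it is holomorphic, and if it vanished on a component, U_μ
would be constant on an unbounded connected set, which is incompatible with its logarithmic growth.
So equality held at x after all.

Thus U_μ = U_{μ'} + c almost everywhere, and taking Laplacians gives μ = μ'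
(`integral_eq_of_logPotential_ae_eq`). -/

/-! ### Vague and weak convergence of measures of mass at most one. -/

theorem integrable_of_tendsto_cocompact {E : Type*} [NormedAddCommGroup E]
    [SecondCountableTopology E] [MeasurableSpace E] [BorelSpace E] {f : ℂ → E} (hf : Continuous f)
    (h0 : Tendsto f (cocompact ℂ) (𝓝 0)) (μ : Measure ℂ) [IsFiniteMeasure μ] :
    Integrable f μ :=
  (ZeroAtInftyContinuousMap.toBCF ⟨⟨f, hf⟩, h0⟩).integrable μ

theorem isFiniteMeasure_of_univ_le_one {μ : Measure ℂ} (h : μ Set.univ ≤ 1) :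
    IsFiniteMeasure μ := ⟨h.trans_lt ENNReal.one_lt_top⟩

theorem norm_integral_le_of_norm_le_of_univ_le_one {μ : Measure ℂ} (h : μ Set.univ ≤ 1)
    {f : ℂ → ℝ} {ε : ℝ} (hε : 0 ≤ ε) (hf : ∀ x, ‖f x‖ ≤ ε) : ‖∫ x, f x ∂μ‖ ≤ ε := by
  have := isFiniteMeasure_of_univ_le_one h
  refine (norm_integral_le_of_norm_le_const (C := ε) (Eventually.of_forall hf)).trans ?_
  have : μ.real Set.univ ≤ 1 := ENNReal.toReal_le_of_le_ofReal zero_le_one (by simpa using h)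
  nlinarith

/-- Vague convergence of sub-probability measures tests against functions vanishing at infinity. -/
theorem VagueTendsto.tendsto_integral_real {ν : ℕ → Measure ℂ} {μ : Measure ℂ}
    (h : VagueTendsto ν μ) (hν : ∀ n, ν n Set.univ ≤ 1) (hμ : μ Set.univ ≤ 1) {f : ℂ → ℝ}
    (hf : Continuous f) (h0 : Tendsto f (cocompact ℂ) (𝓝 0)) :
    Tendsto (fun n => ∫ z, f z ∂(ν n)) atTop (𝓝 (∫ z, f z ∂μ)) := by
  have hfin n := isFiniteMeasure_of_univ_le_one (hν n)
  have hfin' := isFiniteMeasure_of_univ_le_one hμ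
  rw [Metric.tendsto_atTop]
  intro ε hε
  -- Clipping at ±ε/4 splits `f` into a uniformly small part `c` and the remainder `f - c`, which
  -- has compact support because `f` is small near infinity.
  set c : ℂ → ℝ := fun z => max (-(ε / 4)) (min (ε / 4) (f z)) with hc
  have hcc : Continuous c := by fun_prop
  have hcle : ∀ z, ‖c z‖ ≤ ε / 4 := fun z => by
    rw [Real.norm_eq_abs, abs_le]
    exact ⟨le_max_left _ _, max_le (by linarith) (min_le_left _ _)⟩
  have hc0 : Tendsto c (cocompact ℂ) (𝓝 0) := by
    have : Tendsto c (cocompact ℂ) (𝓝 (max (-(ε / 4)) (min (ε / 4) 0))) :=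
      tendsto_const_nhds.max (tendsto_const_nhds.min h0)
    rwa [min_eq_right (by positivity), max_eq_right (by linarith)] at this
  have hg : HasCompactSupport (fun z => f z - c z) := by
    obtain ⟨K, hK, hKs⟩ := mem_cocompact.1 (h0 (Metric.ball_mem_nhds 0 (by positivity : 0 < ε / 4)))
    refine HasCompactSupport.intro hK fun z hz => ?_
    have h1 : |f z| < ε / 4 := by simpa using hKs hz
    rw [abs_lt] at h1
    simp only [hc]
    rw [min_eq_right h1.2.le, max_eq_right h1.1.le, sub_self]
  obtain ⟨N, hN⟩ := Metric.tendsto_atTop.1 (h _ (hf.sub hcc) hg) (ε / 4) (by positivity)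
  refine ⟨N, fun n hn => ?_⟩
  have h1 := hN n hn
  have i1 (m : Measure ℂ) [IsFiniteMeasure m] := integrable_of_tendsto_cocompact hf h0 m
  have i2 (m : Measure ℂ) [IsFiniteMeasure m] := integrable_of_tendsto_cocompact hcc hc0 m
  rw [integral_sub' (i1 _) (i2 _), integral_sub' (i1 _) (i2 _), Real.dist_eq] at h1
  have h2 := norm_integral_le_of_norm_le_of_univ_le_one (hν n) (by positivity) hcle
  have h3 := norm_integral_le_of_norm_le_of_univ_le_one hμ (by positivity) hcle
  rw [Real.norm_eq_abs, abs_le] at h2 h3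
  rw [abs_lt] at h1
  rw [Real.dist_eq, abs_lt]
  constructor <;> linarith

theorem VagueTendsto.tendsto_integral_complex {ν : ℕ → Measure ℂ} {μ : Measure ℂ}
    (h : VagueTendsto ν μ) (hν : ∀ n, ν n Set.univ ≤ 1) (hμ : μ Set.univ ≤ 1) {f : ℂ → ℂ}
    (hf : Continuous f) (h0 : Tendsto f (cocompact ℂ) (𝓝 0)) :
    Tendsto (fun n => ∫ z, f z ∂(ν n)) atTop (𝓝 (∫ z, f z ∂μ)) := by
  have hfin n := isFiniteMeasure_of_univ_le_one (hν n)
  have hfin' := isFiniteMeasure_of_univ_le_one hμ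
  have hre : Continuous fun z => (f z).re := Complex.continuous_re.comp hf
  have him : Continuous fun z => (f z).im := Complex.continuous_im.comp hf
  have hre0 : Tendsto (fun z => (f z).re) (cocompact ℂ) (𝓝 0) :=
    (Complex.continuous_re.tendsto 0).comp h0
  have him0 : Tendsto (fun z => (f z).im) (cocompact ℂ) (𝓝 0) :=
    (Complex.continuous_im.tendsto 0).comp h0
  have key (m : Measure ℂ) [IsFiniteMeasure m] :
      ∫ z, f z ∂m = ((∫ z, (f z).re ∂m : ℝ) : ℂ) + ((∫ z, (f z).im ∂m : ℝ) : ℂ) * Complex.I := by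
    have hi : Integrable f m := by
      have := ((integrable_of_tendsto_cocompact hre hre0 m).ofReal (𝕜 := ℂ)).add
        (((integrable_of_tendsto_cocompact him him0 m).ofReal (𝕜 := ℂ)).mul_const Complex.I)
      refine this.congr (Eventually.of_forall fun z => ?_)
      simp [Complex.re_add_im]
    exact (integral_re_add_im (𝕜 := ℂ) hi).symm
  simp_rw [key]
  exact ((Complex.continuous_ofReal.tendsto _).comp
    (h.tendsto_integral_real hν hμ hre hre0)).add
    (((Complex.continuous_ofReal.tendsto _).comp
    (h.tendsto_integral_real hν hμ him him0)).mul_const _)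

/-- Cutoffs equal to one on large balls carry the mass bound to the limit; mass can only be lost. -/
theorem VagueTendsto.univ_le_one {ν : ℕ → Measure ℂ} {μ : Measure ℂ} [IsLocallyFiniteMeasure μ]
    (h : VagueTendsto ν μ) (hν : ∀ n, ν n Set.univ ≤ 1) : μ Set.univ ≤ 1 := by
  have hK : ∀ n : ℕ, μ (Metric.closedBall 0 n) ≤ 1 := fun n => by
    obtain ⟨f, hf1, -, hfc, hf⟩ := exists_continuous_one_zero_of_isCompact
      (isCompact_closedBall (0 : ℂ) n) isClosed_empty (Set.disjoint_empty _)
    have hle : ∫ z, f z ∂μ ≤ 1 := by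
      refine le_of_tendsto (h f f.continuous hfc) (Eventually.of_forall fun m => ?_)
      refine (le_abs_self _).trans
        (norm_integral_le_of_norm_le_of_univ_le_one (hν m) zero_le_one fun x => ?_)
      rw [Real.norm_eq_abs, abs_le]
      exact ⟨by linarith [(hf x).1], (hf x).2⟩
    have h2 : μ.real (Metric.closedBall 0 n) ≤ ∫ z, f z ∂μ := by
      rw [← integral_indicator_one Metric.isClosed_closedBall.measurableSet]
      refine integral_mono ?_ (f.continuous.integrable_of_hasCompactSupport hfc) fun x => ?_
      · exact (integrableOn_const (C := (1 : ℝ))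
          (isCompact_closedBall (0 : ℂ) n).measure_lt_top.ne).integrable_indicator
          Metric.isClosed_closedBall.measurableSet
      · by_cases hx : x ∈ Metric.closedBall (0 : ℂ) n
        · simp [Set.indicator_of_mem hx, hf1 hx]
        · simp [Set.indicator_of_notMem hx, (hf x).1]
    have h3 := h2.trans hle
    rw [measureReal_def] at h3
    rw [← ENNReal.ofReal_toReal (isCompact_closedBall (0 : ℂ) n).measure_lt_top.ne]
    simpa using h3
  have hmono : Monotone fun n : ℕ => Metric.closedBall (0 : ℂ) n := fun a b hab =>
    Metric.closedBall_subset_closedBall (by exact_mod_cast hab)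
  have := tendsto_measure_iUnion_atTop (μ := μ) hmono
  rw [Metric.iUnion_closedBall_nat] at this
  exact le_of_tendsto' this hK

/-- Every sequence of probability measures on the plane has a vaguely convergent subsequence. -/
theorem exists_subseq_vagueTendsto (ν : ℕ → Measure ℂ) [hν : ∀ n, IsProbabilityMeasure (ν n)] :
    ∃ (φ : ℕ → ℕ) (ν' : Measure ℂ), StrictMono φ ∧ ν' Set.univ ≤ 1 ∧
      VagueTendsto (fun n => ν (φ n)) ν' := by
  -- Squeezing the plane into the open unit ball makes the images tight, so Prokhorov's theorem
  -- applies. Mass escaping to infinity shows up on the unit circle, and pulling the limit back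
  -- along `e` discards it.
  set e : ℂ → ℂ := ⇑(OpenPartialHomeomorph.univUnitBall (E := ℂ)) with he
  have hec : Continuous e := by
    have := (OpenPartialHomeomorph.univUnitBall (E := ℂ)).continuousOn
    exact continuousOn_univ.1 this
  have hem : Measurable e := hec.measurable
  have hball : ∀ z, e z ∈ Metric.ball (0 : ℂ) 1 := fun z => by
    exact (OpenPartialHomeomorph.univUnitBall (E := ℂ)).map_source (x := z) (Set.mem_univ z)
  have hemb : IsOpenEmbedding e :=
    OpenPartialHomeomorph.isOpenEmbedding (OpenPartialHomeomorph.univUnitBall (E := ℂ)) rfl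
  let p : ℕ → ProbabilityMeasure ℂ := fun n =>
    ⟨(ν n).map e, Measure.isProbabilityMeasure_map hem.aemeasurable⟩
  have htight : IsTightMeasureSet {((m : ProbabilityMeasure ℂ) : Measure ℂ) | m ∈ Set.range p} := by
    rw [isTightMeasureSet_iff_exists_isCompact_measure_compl_le]
    intro ε _
    refine ⟨Metric.closedBall 0 1, isCompact_closedBall _ _, ?_⟩
    rintro _ ⟨_, ⟨n, rfl⟩, rfl⟩
    change (ν n).map e _ ≤ ε
    rw [Measure.map_apply hem Metric.isClosed_closedBall.measurableSet.compl]
    have : e ⁻¹' (Metric.closedBall 0 1)ᶜ = ∅ := by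
      ext z
      simpa using (Metric.ball_subset_closedBall (hball z))
    simp [this]
  obtain ⟨π, -, φ, hφ, hlim⟩ := (isCompact_closure_of_isTightMeasureSet htight).isSeqCompact
    (fun n => subset_closure (Set.mem_range_self n))
  have hmeq : MeasurableEmbedding e := hemb.measurableEmbedding
  refine ⟨φ, (π : Measure ℂ).comap e, hφ, ?_, ?_⟩
  · rw [hmeq.comap_apply]
    exact prob_le_one
  intro f hf hfc
  set g : ℂ → ℝ := Function.extend e f 0 with hg
  have hgc : Continuous g := by
    have := hfc.isCompact.image hec
    rw [continuous_iff_continuousAt]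
    intro z
    by_cases hz : z ∈ Set.range e
    · obtain ⟨y, rfl⟩ := hz
      rw [← hemb.continuousAt_iff]
      have : g ∘ e = f := funext fun x => hemb.injective.extend_apply _ _ _
      rw [this]
      exact hf.continuousAt
    · have hz' : z ∉ e '' tsupport f := fun ⟨y, _, hy⟩ => hz ⟨y, hy⟩
      have hev : ∀ᶠ x in 𝓝 z, g x = 0 := by
        filter_upwards [this.isClosed.isOpen_compl.mem_nhds hz'] with x hx
        by_cases hx' : x ∈ Set.range e
        · obtain ⟨y, rfl⟩ := hx'
          rw [hg, hemb.injective.extend_apply]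
          by_contra h0
          exact hx ⟨y, subset_tsupport _ h0, rfl⟩
        · rw [hg, Function.extend_apply' _ _ _ hx']; rfl
      exact (continuousAt_congr hev).2 continuousAt_const
  have hgcs : HasCompactSupport g := by
    refine HasCompactSupport.intro (hfc.isCompact.image hec) fun x hx => ?_
    by_cases hx' : x ∈ Set.range e
    · obtain ⟨y, rfl⟩ := hx'
      rw [hg, hemb.injective.extend_apply]
      by_contra h0
      exact hx ⟨y, subset_tsupport _ h0, rfl⟩
    · rw [hg, Function.extend_apply' _ _ _ hx']; rfl
  obtain ⟨C, hC⟩ := hgcs.exists_bound_of_continuous hgc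
  have h1 := (ProbabilityMeasure.tendsto_iff_forall_integral_tendsto.1 hlim)
    (BoundedContinuousFunction.ofNormedAddCommGroup g hgc C hC)
  have h2 : ∀ z, g (e z) = f z := fun z => hemb.injective.extend_apply _ _ _
  have h3 : ∫ z, f z ∂((π : Measure ℂ).comap e) = ∫ z, g z ∂(π : Measure ℂ) := by
    have : ∫ z, f z ∂((π : Measure ℂ).comap e) = ∫ z, g (e z) ∂((π : Measure ℂ).comap e) := by
      simp_rw [h2]
    rw [this, ← hmeq.integral_map, hmeq.map_comap]
    refine setIntegral_eq_integral_of_forall_compl_eq_zero fun x hx => ?_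
    rw [hg, Function.extend_apply' _ _ _ hx]; rfl
  rw [h3]
  refine h1.congr fun n => ?_
  change ∫ z, g z ∂((ν (φ n)).map e) = _
  rw [hmeq.integral_map]
  simp_rw [h2]

/-- Two measures on the plane of mass at most one agree if they agree on smooth compactly supported
functions. -/
theorem measure_ext_of_integral_contDiff {μ ν : Measure ℂ} (hμ : μ Set.univ ≤ 1)
    (hν : ν Set.univ ≤ 1)
    (h : ∀ φ : ℂ → ℝ, ContDiff ℝ ∞ φ → HasCompactSupport φ → ∫ z, φ z ∂μ = ∫ z, φ z ∂ν) :
    μ = ν := by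
  have hfin := isFiniteMeasure_of_univ_le_one hμ
  have hfin' := isFiniteMeasure_of_univ_le_one hν
  refine Measure.ext_of_integral_eq_on_compactlySupported fun f => ?_
  refine eq_of_forall_dist_le fun ε hε => ?_
  obtain ⟨δ, hδ, hfδ⟩ := Metric.uniformContinuous_iff.1
    (f.hasCompactSupport.uniformContinuous_of_continuous f.continuous) (ε / 2) (by positivity)
  obtain ⟨g, hg, hgf⟩ := f.continuous.exists_contDiff_dist_le_of_forall_mem_ball_dist_le hδ
  have hclose : ∀ z, ‖f z - g z‖ ≤ ε / 2 := fun z => by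
    rw [← dist_eq_norm, dist_comm]
    exact hgf z _ fun x hx => (hfδ hx).le
  have hgs : HasCompactSupport g := by
    refine HasCompactSupport.intro (f.hasCompactSupport.isCompact.cthickening (r := δ))
      fun x hx => ?_
    have h0 : ∀ y ∈ Metric.ball x δ, f y = 0 := fun y hy => by
      by_contra h0
      refine hx (Metric.mem_cthickening_of_dist_le x y δ _ (subset_tsupport _ h0) ?_)
      rw [dist_comm]
      exact (Metric.mem_ball.1 hy).le
    -- The approximation bound holds with tolerance 0 wherever `f` vanishes on the whole δ-ball, so
    -- the approximant vanishes there exactly.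
    have hgf' : ∀ a δ', (∀ x ∈ Metric.ball a δ, dist (f x) (f a) ≤ δ') →
        dist (g a) (f a) ≤ δ' := hgf
    have := hgf' x 0 fun y hy => by
      rw [h0 y hy, h0 x (Metric.mem_ball_self hδ), dist_self]
    rw [h0 x (Metric.mem_ball_self hδ)] at this
    exact dist_le_zero.1 this
  have i1 (m : Measure ℂ) [IsFiniteMeasure m] : Integrable f m :=
    f.continuous.integrable_of_hasCompactSupport f.hasCompactSupport
  have i2 (m : Measure ℂ) [IsFiniteMeasure m] : Integrable g m :=
    hg.continuous.integrable_of_hasCompactSupport hgs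
  have h1 := norm_integral_le_of_norm_le_of_univ_le_one hμ (by positivity) hclose
  have h2 := norm_integral_le_of_norm_le_of_univ_le_one hν (by positivity) hclose
  rw [integral_sub (i1 _) (i2 _), Real.norm_eq_abs, abs_le] at h1 h2
  rw [h g hg hgs] at h1
  rw [Real.dist_eq, abs_le]
  constructor <;> linarith

theorem VagueTendsto.comp_tendsto {ν : ℕ → Measure ℂ} {μ : Measure ℂ} (h : VagueTendsto ν μ)
    {φ : ℕ → ℕ} (hφ : Tendsto φ atTop atTop) : VagueTendsto (fun n => ν (φ n)) μ :=
  fun f hf hfc => (h f hf hfc).comp hφ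

/-- Vague convergence to a measure without loss of mass is weak convergence. -/
theorem VagueTendsto.weakTendsto {ν : ℕ → Measure ℂ} {μ : Measure ℂ} (h : VagueTendsto ν μ)
    (hν : ∀ n, ν n Set.univ ≤ 1) (hμ : μ Set.univ = 1) : WeakTendsto ν μ := by
  have hfin n := isFiniteMeasure_of_univ_le_one (hν n)
  have hμp : IsProbabilityMeasure μ := ⟨hμ⟩
  intro f
  rw [Metric.tendsto_atTop]
  intro ε hε
  have hM : 0 < ‖f‖ + 1 := by positivity
  obtain ⟨K, hK, hKε⟩ : ∃ K : Set ℂ, IsCompact K ∧ 1 - ε / (8 * (‖f‖ + 1)) < μ.real K := by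
    have hmono : Monotone fun n : ℕ => Metric.closedBall (0 : ℂ) n := fun a b hab =>
      Metric.closedBall_subset_closedBall (by exact_mod_cast hab)
    have := tendsto_measure_iUnion_atTop (μ := μ) hmono
    rw [Metric.iUnion_closedBall_nat, hμ] at this
    have h2 := (ENNReal.tendsto_toReal ENNReal.one_ne_top).comp this
    obtain ⟨n, hn⟩ := (h2.eventually (lt_mem_nhds (a := 1 - ε / (8 * (‖f‖ + 1)))
      (by rw [ENNReal.toReal_one]; linarith [show 0 < ε / (8 * (‖f‖ + 1)) by positivity]))).exists
    exact ⟨_, isCompact_closedBall _ _, hn⟩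
  obtain ⟨χ, hχ1, -, hχc, hχ⟩ := exists_continuous_one_zero_of_isCompact hK isClosed_empty
    (Set.disjoint_empty _)
  have iχ (m : Measure ℂ) [IsFiniteMeasure m] : Integrable χ m :=
    χ.continuous.integrable_of_hasCompactSupport hχc
  have ifχ (m : Measure ℂ) [IsFiniteMeasure m] : Integrable (fun z => f z * χ z) m :=
    (f.continuous.mul χ.continuous).integrable_of_hasCompactSupport hχc.mul_left
  have iff' (m : Measure ℂ) [IsFiniteMeasure m] : Integrable f m := f.integrable m
  have hχμ : 1 - ε / (8 * (‖f‖ + 1)) < ∫ z, χ z ∂μ := by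
    refine hKε.trans_le ?_
    rw [← integral_indicator_one hK.measurableSet]
    refine integral_mono ((integrable_const (1 : ℝ)).indicator hK.measurableSet) (iχ _) fun x => ?_
    by_cases hx : x ∈ K
    · simp [Set.indicator_of_mem hx, hχ1 hx]
    · simp [Set.indicator_of_notMem hx, (hχ x).1]
  have key (m : Measure ℂ) [IsFiniteMeasure m] (hm : m Set.univ ≤ 1) :
      |∫ z, f z ∂m - ∫ z, f z * χ z ∂m| ≤ (‖f‖ + 1) * (1 - ∫ z, χ z ∂m) := by
    rw [← integral_sub (iff' m) (ifχ m)]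
    have h1 : ‖∫ z, (f z - f z * χ z) ∂m‖ ≤ ∫ z, (‖f‖ + 1) * (1 - χ z) ∂m := by
      refine norm_integral_le_of_norm_le (((integrable_const 1).sub (iχ m)).const_mul _)
        (Eventually.of_forall fun z => ?_)
      rw [show f z - f z * χ z = f z * (1 - χ z) by ring, norm_mul,
        Real.norm_of_nonneg (by linarith [(hχ z).2] : 0 ≤ 1 - χ z)]
      exact mul_le_mul_of_nonneg_right ((f.norm_coe_le_norm z).trans (by linarith))
        (by linarith [(hχ z).2])
    rw [Real.norm_eq_abs] at h1
    refine h1.trans ?_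
    rw [integral_const_mul, integral_sub (integrable_const _) (iχ m)]
    have : m.real Set.univ ≤ 1 := ENNReal.toReal_le_of_le_ofReal zero_le_one (by simpa using hm)
    simp only [integral_const, smul_eq_mul, mul_one]
    gcongr
  -- Since μ has full mass, vague convergence forces almost all the mass of `ν n` under the cutoff
  -- `χ`: tightness comes for free.
  have e1 := (h χ χ.continuous hχc).eventually (lt_mem_nhds hχμ)
  have e2 := (h _ (f.continuous.mul χ.continuous) hχc.mul_left).eventually
    (Metric.ball_mem_nhds _ (by positivity : 0 < ε / 2))
  obtain ⟨N, hN⟩ := eventually_atTop.1 (e1.and e2)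
  refine ⟨N, fun n hn => ?_⟩
  obtain ⟨h1, h2⟩ := hN n hn
  have k1 := key (ν n) (hν n)
  have k2 := key μ hμ.le
  have e3 : (‖f‖ + 1) * (ε / (8 * (‖f‖ + 1))) = ε / 8 := by field_simp
  have e4 : (‖f‖ + 1) * (1 - ∫ z, χ z ∂(ν n)) ≤ (‖f‖ + 1) * (ε / (8 * (‖f‖ + 1))) := by
    gcongr; linarith
  have e5 : (‖f‖ + 1) * (1 - ∫ z, χ z ∂μ) ≤ (‖f‖ + 1) * (ε / (8 * (‖f‖ + 1))) := by
    gcongr; linarith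
  rw [Real.dist_eq, abs_lt] at h2
  rw [abs_le] at k1 k2
  rw [Real.dist_eq, abs_lt]
  simp only [Pi.mul_apply] at h2
  constructor <;> linarith

/-! ### The dominating weight and its potential. -/

/-- The singular weight `‖z - w‖ ^ (-3/2)`. -/
noncomputable def singKernel (z w : ℂ) : ℝ≥0∞ :=
  (ENNReal.ofReal (‖z - w‖ * √‖z - w‖))⁻¹

/-- The potential of a measure with respect to the weight `‖z - w‖ ^ (-3/2)`. -/
noncomputable def singPotential (ν : Measure ℂ) (z : ℂ) : ℝ≥0∞ := ∫⁻ w, singKernel z w ∂ν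

theorem measurable_singKernel : Measurable (Function.uncurry singKernel) := by
  unfold singKernel Function.uncurry
  fun_prop

theorem measurable_singPotential (ν : Measure ℂ) [SFinite ν] : Measurable (singPotential ν) :=
  measurable_singKernel.lintegral_prod_right

/-- The exponent 3/2 is below the dimension 2, so the weight is integrable on a unit ball, and off
that ball it is at most 1. Translation invariance makes the bound uniform in `w`. -/
theorem exists_lintegral_singKernel_le : ∃ C : ℝ≥0∞, C < ⊤ ∧ ∀ m : Measure ℂ, m ≤ volume →
    ∀ w, ∫⁻ z, singKernel z w ∂m ≤ C + m Set.univ := by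
  have hint : IntegrableOn (fun z : ℂ => ‖z‖ ^ (-(3 / 2 : ℝ))) (Metric.ball 0 1) volume := by
    refine integrableOn_ball_of_norm_le_rpow (C := 1) (α := 3 / 2) ?_ ?_ ?_ ?_
    · simp
    · rw [Complex.finrank_real_complex]; norm_num
    · refine Eventually.of_forall fun z => ?_
      rw [one_mul, Real.norm_of_nonneg (by positivity)]
    · exact (measurable_norm.pow_const _).aestronglyMeasurable
  refine ⟨∫⁻ z in Metric.ball (0 : ℂ) 1, singKernel z 0, ?_, fun m hm w => ?_⟩
  · refine lt_of_le_of_lt (lintegral_mono_ae ?_) hint.2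
    refine Eventually.filter_mono (ae_mono Measure.restrict_le_self) ?_
    filter_upwards [Measure.ae_ne volume (0 : ℂ)] with z hz
    have hz' : 0 < ‖z‖ := norm_pos_iff.2 hz
    rw [singKernel, sub_zero, ← ENNReal.ofReal_inv_of_pos (by positivity), ← ofReal_norm,
      Real.norm_of_nonneg (by positivity), Real.rpow_neg hz'.le,
      show (3 / 2 : ℝ) = 1 + 1 / 2 by norm_num, Real.rpow_add hz', Real.rpow_one,
      ← Real.sqrt_eq_rpow]
  · have h1 : ∀ z, singKernel z w ≤ (Metric.ball w 1).indicator (fun z => singKernel z w) z + 1 := by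
      intro z
      by_cases hz : z ∈ Metric.ball w 1
      · rw [Set.indicator_of_mem hz]; exact le_self_add
      · rw [Set.indicator_of_notMem hz, zero_add, singKernel, ENNReal.inv_le_one,
          ENNReal.one_le_ofReal]
        have h2 : 1 ≤ ‖z - w‖ := by simpa [dist_eq_norm] using hz
        exact one_le_mul_of_one_le_of_one_le h2 (Real.one_le_sqrt.2 h2)
    refine (lintegral_mono h1).trans ?_
    rw [lintegral_add_right _ measurable_const, lintegral_one]
    refine add_le_add ?_ le_rfl
    refine (lintegral_mono' hm le_rfl).trans ?_
    rw [← lintegral_indicator Metric.isOpen_ball.measurableSet,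
      ← lintegral_add_right_eq_self _ w]
    refine lintegral_mono fun z => ?_
    by_cases hz : z ∈ Metric.ball (0 : ℂ) 1
    · rw [Set.indicator_of_mem hz, Set.indicator_of_mem (by simpa [dist_eq_norm] using hz)]
      simp [singKernel]
    · rw [Set.indicator_of_notMem hz, Set.indicator_of_notMem (by simpa [dist_eq_norm] using hz)]

theorem exists_lintegral_singPotential_le : ∃ C : ℝ≥0∞, C < ⊤ ∧ ∀ m ν : Measure ℂ, SFinite m →
    SFinite ν → m ≤ volume → ∫⁻ z, singPotential ν z ∂m ≤ (C + m Set.univ) * ν Set.univ := by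
  obtain ⟨C, hC, h⟩ := exists_lintegral_singKernel_le
  refine ⟨C, hC, fun m ν hm hν hmv => ?_⟩
  unfold singPotential
  rw [lintegral_lintegral_swap measurable_singKernel.aemeasurable]
  refine (lintegral_mono fun w => h m hmv w).trans ?_
  rw [lintegral_const]

/-- A finite measure on the plane with the same null sets as Lebesgue measure, and below it. -/
theorem exists_finite_measure_le_volume : ∃ m : Measure ℂ, IsFiniteMeasure m ∧ m ≤ volume ∧
    volume ≪ m := by
  obtain ⟨g, hg0, hgm, hg⟩ := exists_pos_lintegral_lt_of_sigmaFinite (volume : Measure ℂ)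
    (ε := 1) one_ne_zero
  refine ⟨volume.withDensity fun z => min (g z) 1, ?_, ?_, ?_⟩
  · refine isFiniteMeasure_withDensity (ne_of_lt ?_)
    exact (lintegral_mono fun z => min_le_left _ _).trans_lt (hg.trans_le le_top)
  · conv_rhs => rw [← withDensity_one (μ := (volume : Measure ℂ))]
    exact withDensity_mono (Eventually.of_forall fun z => min_le_right _ _)
  · refine withDensity_absolutelyContinuous' (by fun_prop) (Eventually.of_forall fun z => ?_)
    exact (lt_min (by exact_mod_cast hg0 z) one_pos).ne'

theorem ae_singPotential_lt_top (ν : Measure ℂ) [IsFiniteMeasure ν] :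
    ∀ᵐ z, singPotential ν z < ⊤ := by
  obtain ⟨m, hm, hmv, hvm⟩ := exists_finite_measure_le_volume
  obtain ⟨C, hC, h⟩ := exists_lintegral_singPotential_le
  refine hvm.ae_le (ae_lt_top (measurable_singPotential ν) (ne_of_lt ?_))
  exact (h m ν inferInstance inferInstance hmv).trans_lt (by finiteness)

/-- The weight is `⊤` on the diagonal, so a finite potential at `z` excludes an atom there. This
keeps the values of the kernels at `w = z`, such as log 0 = 0, harmless. -/
theorem ae_ne_of_singPotential_lt_top {ν : Measure ℂ} {z : ℂ}
    (h : singPotential ν z < ⊤) : ∀ᵐ w ∂ν, w ≠ z := by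
  have hm : Measurable fun w => singKernel z w := measurable_singKernel.of_uncurry_left
  filter_upwards [ae_lt_top hm h.ne] with w hw hwz
  simp [hwz, singKernel] at hw

/-! ### Convergence in measure of singular integrals. -/

section Regularization

variable {E : Type*} [NormedAddCommGroup E]
  {K : ℂ → ℂ → E} {Kr : ℝ → ℂ → ℂ → E}

theorem integrable_of_enorm_sub_le (hK : StronglyMeasurable (Function.uncurry K))
    (hint : ∀ ε, 0 < ε → ε ≤ 1 → ∀ z (ν : Measure ℂ), IsFiniteMeasure ν → Integrable (Kr ε z) ν)
    (hle : ∀ ε, 0 < ε → ε ≤ 1 → ∀ z w,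
      ‖K z w - Kr ε z w‖ₑ ≤ ENNReal.ofReal (√ε) * singKernel z w)
    {ν : Measure ℂ} [IsFiniteMeasure ν] {z : ℂ} (hz : singPotential ν z < ⊤) :
    Integrable (K z) ν := by
  have h1 := hint 1 one_pos le_rfl z ν inferInstance
  have hKz : StronglyMeasurable (K z) := hK.comp_measurable measurable_prodMk_left
  have : Integrable (fun w => K z w - Kr 1 z w) ν := by
    refine ⟨hKz.aestronglyMeasurable.sub h1.1, ?_⟩
    refine lt_of_le_of_lt (lintegral_mono fun w => hle 1 one_pos le_rfl z w) ?_
    simpa [singPotential] using hz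
  exact (this.add h1).congr (Eventually.of_forall fun w => by simp)

theorem enorm_integral_sub_le [NormedSpace ℝ E] (hK : StronglyMeasurable (Function.uncurry K))
    (hint : ∀ ε, 0 < ε → ε ≤ 1 → ∀ z (ν : Measure ℂ), IsFiniteMeasure ν → Integrable (Kr ε z) ν)
    (hle : ∀ ε, 0 < ε → ε ≤ 1 → ∀ z w,
      ‖K z w - Kr ε z w‖ₑ ≤ ENNReal.ofReal (√ε) * singKernel z w)
    {ν : Measure ℂ} [IsFiniteMeasure ν] {z : ℂ} (hz : singPotential ν z < ⊤)
    {ε : ℝ} (hε : 0 < ε) (hε1 : ε ≤ 1) :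
    ‖∫ w, K z w ∂ν - ∫ w, Kr ε z w ∂ν‖ₑ ≤ ENNReal.ofReal (√ε) * singPotential ν z := by
  rw [← integral_sub (integrable_of_enorm_sub_le hK hint hle hz) (hint ε hε hε1 z ν inferInstance)]
  refine (enorm_integral_le_lintegral_enorm _).trans ?_
  refine (lintegral_mono fun w => hle ε hε hε1 z w).trans ?_
  rw [lintegral_const_mul' _ _ ENNReal.ofReal_ne_top, singPotential]

/-- A three-term estimate. The regularised integrals converge pointwise, and the regularisation
error is √ε times `singPotential`, whose integral against `m` is bounded uniformly over measures of
mass at most one; Markov's inequality then controls the error in measure. -/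
theorem tendstoInMeasure_integral_kernel [NormedSpace ℝ E] (hK : StronglyMeasurable (Function.uncurry K))
    (hKr : ∀ ε, StronglyMeasurable (Function.uncurry (Kr ε)))
    (hint : ∀ ε, 0 < ε → ε ≤ 1 → ∀ z (ν : Measure ℂ), IsFiniteMeasure ν → Integrable (Kr ε z) ν)
    (hle : ∀ ε, 0 < ε → ε ≤ 1 → ∀ z w,
      ‖K z w - Kr ε z w‖ₑ ≤ ENNReal.ofReal (√ε) * singKernel z w)
    {ν : ℕ → Measure ℂ} {μ : Measure ℂ} (hν : ∀ n, ν n Set.univ ≤ 1) (hμ : μ Set.univ ≤ 1)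
    (hlim : ∀ ε, 0 < ε → ε ≤ 1 → ∀ z,
      Tendsto (fun n => ∫ w, Kr ε z w ∂(ν n)) atTop (𝓝 (∫ w, Kr ε z w ∂μ)))
    {m : Measure ℂ} [IsFiniteMeasure m] (hm : m ≤ volume) :
    TendstoInMeasure m (fun n z => ∫ w, K z w ∂(ν n)) atTop (fun z => ∫ w, K z w ∂μ) := by
  have hfin n := isFiniteMeasure_of_univ_le_one (hν n)
  have hfin' := isFiniteMeasure_of_univ_le_one hμ
  obtain ⟨C, hC, hsing⟩ := exists_lintegral_singPotential_le
  have hB : C + m Set.univ < ⊤ := by finiteness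
  rw [tendstoInMeasure_iff_enorm]
  intro η hη hηt
  have hη3 : 0 < η / 3 := by simpa using hη.ne'
  have hη3t : η / 3 ≠ ⊤ := by finiteness
  have htail (ε : ℝ) (hε : 0 < ε) (hε1 : ε ≤ 1) (ρ : Measure ℂ) (hρ : ρ Set.univ ≤ 1) :
      m {z | η / 3 ≤ ‖∫ w, K z w ∂ρ - ∫ w, Kr ε z w ∂ρ‖ₑ} ≤
        ENNReal.ofReal (√ε) * (C + m Set.univ) / (η / 3) := by
    have hfin'' := isFiniteMeasure_of_univ_le_one hρ
    have h1 : m {z | η / 3 ≤ ‖∫ w, K z w ∂ρ - ∫ w, Kr ε z w ∂ρ‖ₑ} ≤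
        m {z | η / 3 ≤ ENNReal.ofReal (√ε) * singPotential ρ z} := by
      refine measure_mono_ae ?_
      filter_upwards [(Measure.absolutelyContinuous_of_le hm).ae_le (ae_singPotential_lt_top ρ)]
        with z hz hz'
      exact le_trans hz' (enorm_integral_sub_le hK hint hle hz hε hε1)
    refine h1.trans ?_
    refine (meas_ge_le_lintegral_div ((measurable_singPotential ρ).const_mul _).aemeasurable
      hη3.ne' hη3t).trans ?_
    rw [lintegral_const_mul _ (measurable_singPotential ρ)]
    gcongr
    refine (hsing m ρ inferInstance inferInstance hm).trans ?_
    calc _ ≤ (C + m Set.univ) * 1 := by gcongr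
      _ = _ := mul_one _
  have hmid (ε : ℝ) (hε : 0 < ε) (hε1 : ε ≤ 1) :
      Tendsto (fun n => m {z | η / 3 ≤ ‖∫ w, Kr ε z w ∂(ν n) - ∫ w, Kr ε z w ∂μ‖ₑ}) atTop
        (𝓝 0) := by
    have h1 : TendstoInMeasure m (fun n z => ∫ w, Kr ε z w ∂(ν n)) atTop
        (fun z => ∫ w, Kr ε z w ∂μ) :=
      tendstoInMeasure_of_tendsto_ae
        (fun n => ((hKr ε).integral_prod_right (ν := ν n)).aestronglyMeasurable)
        (Eventually.of_forall fun z => hlim ε hε hε1 z)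
    exact tendstoInMeasure_iff_enorm.1 h1 _ hη3 hη3t
  rw [ENNReal.tendsto_atTop_zero]
  intro θ hθ
  have hsqrt : Tendsto (fun ε : ℝ => ENNReal.ofReal (√ε) * (C + m Set.univ) / (η / 3)) (𝓝[>] 0)
      (𝓝 0) := by
    have h1 : Tendsto (fun ε : ℝ => ENNReal.ofReal (√ε)) (𝓝[>] 0) (𝓝 0) := by
      have : Tendsto (fun ε : ℝ => ENNReal.ofReal (√ε)) (𝓝 0) (𝓝 (ENNReal.ofReal (√0))) :=
        (ENNReal.continuous_ofReal.comp Real.continuous_sqrt).tendsto 0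
      rw [Real.sqrt_zero, ENNReal.ofReal_zero] at this
      exact this.mono_left nhdsWithin_le_nhds
    have h2 := ENNReal.Tendsto.mul_const (b := (C + m Set.univ) / (η / 3)) h1
      (Or.inr (ENNReal.div_lt_top hB.ne hη3.ne').ne)
    rw [zero_mul] at h2
    exact h2.congr fun ε => by rw [mul_div_assoc]
  have hθ3 : 0 < θ / 3 := by simpa using hθ.ne'
  obtain ⟨ε, hεs, hε, hε1⟩ := ((hsqrt.eventually (gt_mem_nhds hθ3)).and
    (Ioc_mem_nhdsGT (zero_lt_one' ℝ))).exists
  obtain ⟨N, hN⟩ := (ENNReal.tendsto_atTop_zero.1 (hmid ε hε hε1)) (θ / 3) hθ3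
  refine ⟨N, fun n hn => ?_⟩
  have hsub : {z | η ≤ ‖∫ w, K z w ∂(ν n) - ∫ w, K z w ∂μ‖ₑ} ⊆
      {z | η / 3 ≤ ‖∫ w, K z w ∂(ν n) - ∫ w, Kr ε z w ∂(ν n)‖ₑ} ∪
      {z | η / 3 ≤ ‖∫ w, Kr ε z w ∂(ν n) - ∫ w, Kr ε z w ∂μ‖ₑ} ∪
      {z | η / 3 ≤ ‖∫ w, K z w ∂μ - ∫ w, Kr ε z w ∂μ‖ₑ} := by
    intro z hz
    by_contra hcon
    simp only [Set.mem_union, Set.mem_ofPred_eq, not_or, not_le] at hcon hz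
    obtain ⟨⟨h1, h2⟩, h3⟩ := hcon
    refine absurd hz (not_le.2 ?_)
    calc ‖∫ w, K z w ∂(ν n) - ∫ w, K z w ∂μ‖ₑ
        = ‖((∫ w, K z w ∂(ν n) - ∫ w, Kr ε z w ∂(ν n)) +
          (∫ w, Kr ε z w ∂(ν n) - ∫ w, Kr ε z w ∂μ)) -
          (∫ w, K z w ∂μ - ∫ w, Kr ε z w ∂μ)‖ₑ := by congr 1; abel
      _ ≤ _ := enorm_sub_le
      _ ≤ _ := add_le_add_left (enorm_add_le _ _) _
      _ < η / 3 + η / 3 + η / 3 := by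
        exact ENNReal.add_lt_add (ENNReal.add_lt_add h1 h2) h3
      _ = η := ENNReal.add_thirds η
  refine (measure_mono hsub).trans ((measure_union_le _ _).trans ?_)
  refine (add_le_add_left (measure_union_le _ _) _).trans ?_
  rw [← ENNReal.add_thirds θ]
  exact add_le_add (add_le_add ((htail ε hε hε1 _ (hν n)).trans hεs.le) (hN n hn))
    ((htail ε hε hε1 _ hμ).trans hεs.le)

end Regularization

/-! ### The logarithmic and Cauchy kernels and their regularisations. -/

/-- The logarithmic kernel, normalised to vanish as `w → ∞`. -/
noncomputable def logKernel (z w : ℂ) : ℝ :=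
  Real.log ‖z - w‖ - 1 / 2 * Real.log (1 + ‖w‖ ^ 2)

/-- A smooth regularisation of `logKernel`. -/
noncomputable def logKernelReg (ε : ℝ) (z w : ℂ) : ℝ :=
  1 / 2 * Real.log (‖z - w‖ ^ 2 + ε ^ 2) - 1 / 2 * Real.log (1 + ‖w‖ ^ 2)

/-- A smooth regularisation of the Cauchy kernel `(z - w)⁻¹`. -/
noncomputable def cauchyKernelReg (ε : ℝ) (z w : ℂ) : ℂ :=
  (starRingEnd ℂ) (z - w) / ((‖z - w‖ ^ 2 + ε ^ 2 : ℝ) : ℂ)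

/-- The normalised logarithmic potential of a measure. -/
noncomputable def logPotential (ν : Measure ℂ) (z : ℂ) : ℝ := ∫ w, logKernel z w ∂ν

/-- The Cauchy transform of a measure. -/
noncomputable def cauchyTransform (ν : Measure ℂ) (z : ℂ) : ℂ := ∫ w, (z - w)⁻¹ ∂ν

theorem stronglyMeasurable_logKernel : StronglyMeasurable (Function.uncurry logKernel) := by
  apply Measurable.stronglyMeasurable
  unfold logKernel Function.uncurry
  fun_prop

theorem stronglyMeasurable_logKernelReg (ε : ℝ) :
    StronglyMeasurable (Function.uncurry (logKernelReg ε)) := by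
  apply Measurable.stronglyMeasurable
  unfold logKernelReg Function.uncurry
  fun_prop

theorem stronglyMeasurable_cauchyKernel :
    StronglyMeasurable (Function.uncurry fun z w : ℂ => (z - w)⁻¹) := by
  apply Measurable.stronglyMeasurable
  unfold Function.uncurry
  fun_prop

theorem stronglyMeasurable_cauchyKernelReg (ε : ℝ) :
    StronglyMeasurable (Function.uncurry (cauchyKernelReg ε)) := by
  apply Measurable.stronglyMeasurable
  unfold cauchyKernelReg Function.uncurry
  refine Measurable.div ?_ (by fun_prop)
  exact Complex.continuous_conj.measurable.comp (by fun_prop)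

theorem continuous_logKernelReg {ε : ℝ} (hε : 0 < ε) :
    Continuous (Function.uncurry (logKernelReg ε)) := by
  unfold logKernelReg Function.uncurry
  refine (continuous_const.mul (Continuous.log (by fun_prop) fun p => ?_)).sub
    (continuous_const.mul (Continuous.log (by fun_prop) fun p => ?_)) <;> positivity

theorem continuous_logKernelReg_right {ε : ℝ} (hε : 0 < ε) (z : ℂ) :
    Continuous (logKernelReg ε z) := by
  have h : Continuous fun w : ℂ => (z, w) := Continuous.prodMk_right z
  have := (continuous_logKernelReg hε).comp h
  simpa only [Function.comp_def, Function.uncurry_apply_pair] using this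

theorem continuous_cauchyKernelReg {ε : ℝ} (hε : 0 < ε) (z : ℂ) :
    Continuous (cauchyKernelReg ε z) := by
  unfold cauchyKernelReg
  refine Continuous.div (Complex.continuous_conj.comp (by fun_prop)) (by fun_prop) fun p => ?_
  rw [Ne, Complex.ofReal_eq_zero]
  positivity

theorem tendsto_norm_sub_cocompact (z : ℂ) :
    Tendsto (fun w : ℂ => ‖z - w‖) (cocompact ℂ) atTop := by
  refine tendsto_atTop_mono (fun w => ?_)
    (tendsto_atTop_add_const_right _ (-‖z‖) (tendsto_norm_cocompact_atTop (E := ℂ)))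
  have := norm_sub_norm_le w z
  rw [norm_sub_rev z w]
  linarith

theorem norm_cauchyKernelReg_le (ε : ℝ) (z w : ℂ) : ‖cauchyKernelReg ε z w‖ ≤ ‖z - w‖⁻¹ := by
  unfold cauchyKernelReg
  rw [norm_div, RCLike.norm_conj, Complex.norm_real, Real.norm_of_nonneg (by positivity)]
  rcases (norm_nonneg (z - w)).eq_or_lt with h | h
  · simp [← h]
  · rw [div_le_iff₀ (by positivity), mul_add, pow_two, ← mul_assoc, inv_mul_cancel₀ h.ne', one_mul]
    have : 0 ≤ ‖z - w‖⁻¹ * ε ^ 2 := by positivity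
    linarith

theorem tendsto_cauchyKernelReg (ε : ℝ) (z : ℂ) :
    Tendsto (cauchyKernelReg ε z) (cocompact ℂ) (𝓝 0) :=
  squeeze_zero_norm (norm_cauchyKernelReg_le ε z)
    (tendsto_norm_sub_cocompact z).inv_tendsto_atTop

/-- The kernel is half the logarithm of (‖z - w‖² + ε²)/(1 + ‖w‖²), and this quotient differs from 1
by O(1/‖w‖). -/
theorem tendsto_logKernelReg {ε : ℝ} (hε : 0 < ε) (hε1 : ε ≤ 1) (z : ℂ) :
    Tendsto (logKernelReg ε z) (cocompact ℂ) (𝓝 0) := by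
  have h1 : Tendsto (fun w : ℂ => (‖z - w‖ ^ 2 + ε ^ 2) / (1 + ‖w‖ ^ 2) - 1) (cocompact ℂ)
      (𝓝 0) := by
    have h2 : Tendsto (fun w : ℂ => (‖z‖ + 1) ^ 2 * ‖w‖⁻¹) (cocompact ℂ) (𝓝 0) := by
      have := (tendsto_norm_cocompact_atTop (E := ℂ)).inv_tendsto_atTop.const_mul ((‖z‖ + 1) ^ 2)
      simpa using this
    refine squeeze_zero_norm' ?_ h2
    filter_upwards [(tendsto_norm_cocompact_atTop (E := ℂ)).eventually_ge_atTop 1] with w hw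
    have hb : 0 < 1 + ‖w‖ ^ 2 := by positivity
    rw [div_sub_one hb.ne', norm_div, Real.norm_eq_abs, Real.norm_of_nonneg hb.le,
      div_le_iff₀ hb]
    have h3 : |‖z - w‖ ^ 2 + ε ^ 2 - (1 + ‖w‖ ^ 2)| ≤ (‖z‖ + 1) ^ 2 * ‖w‖ := by
      have h4 := norm_sub_le z w
      have h5 := norm_sub_norm_le w z
      rw [norm_sub_rev w z] at h5
      have h6 := norm_nonneg z
      have h7 := norm_nonneg (z - w)
      have h8 : ε ^ 2 ≤ 1 := by nlinarith
      have h9 := sq_nonneg ε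
      have h11 : |‖z - w‖ - ‖w‖| ≤ ‖z‖ := by rw [abs_le]; constructor <;> linarith
      have h10 : |‖z - w‖ ^ 2 - ‖w‖ ^ 2| ≤ ‖z‖ * (2 * ‖w‖ + ‖z‖) := by
        rw [show ‖z - w‖ ^ 2 - ‖w‖ ^ 2 = (‖z - w‖ - ‖w‖) * (‖z - w‖ + ‖w‖) by ring, abs_mul]
        refine mul_le_mul h11 ?_ (abs_nonneg _) h6
        rw [abs_of_nonneg (by positivity)]; linarith
      have h12 : 0 ≤ (‖z‖ ^ 2 + 1) * (‖w‖ - 1) := mul_nonneg (by positivity) (by linarith)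
      rw [abs_le] at h10 ⊢
      constructor <;> nlinarith
    refine h3.trans ?_
    rw [mul_assoc]
    refine mul_le_mul_of_nonneg_left ?_ (by positivity)
    rw [mul_add, mul_one, pow_two, ← mul_assoc, inv_mul_cancel₀ (by positivity), one_mul]
    have : 0 ≤ ‖w‖⁻¹ := by positivity
    linarith
  have h2 : Tendsto (fun w : ℂ => (‖z - w‖ ^ 2 + ε ^ 2) / (1 + ‖w‖ ^ 2)) (cocompact ℂ)
      (𝓝 1) := by simpa using h1.add_const 1
  have h3 := ((Real.continuousAt_log one_ne_zero).tendsto.comp h2).const_mul (1 / 2)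
  rw [Real.log_one, mul_zero] at h3
  refine h3.congr fun w => ?_
  rw [Function.comp_apply, Real.log_div (by positivity) (by positivity), logKernelReg, mul_sub]

theorem exists_abs_logKernelReg_le {ε : ℝ} (hε : 0 < ε) (R : ℝ) :
    ∃ B, ∀ z w : ℂ, ‖z‖ ≤ R → |logKernelReg ε z w| ≤ B := by
  -- `A` bounds both (‖z - w‖² + ε²)/(1 + ‖w‖²) and its inverse when ‖z‖ ≤ R.
  set A := 2 * R ^ 2 + 3 + ε ^ 2 + (1 + 2 * R ^ 2) / ε ^ 2 with hA
  refine ⟨1 / 2 * Real.log A, fun z w hz => ?_⟩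
  have hA0 : 0 < A := by positivity
  have ha : 0 < ‖z - w‖ ^ 2 + ε ^ 2 := by positivity
  have hb : 0 < 1 + ‖w‖ ^ 2 := by positivity
  have hR : ‖z‖ ^ 2 ≤ R ^ 2 := pow_le_pow_left₀ (norm_nonneg _) hz 2
  have hq : 0 ≤ (1 + 2 * R ^ 2) / ε ^ 2 := by positivity
  have h1 : ‖z - w‖ ^ 2 + ε ^ 2 ≤ A * (1 + ‖w‖ ^ 2) := by
    have h2 := norm_sub_le z w
    have h3 : ‖z - w‖ ^ 2 ≤ 2 * ‖z‖ ^ 2 + 2 * ‖w‖ ^ 2 := by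
      nlinarith [norm_nonneg (z - w), norm_nonneg z, norm_nonneg w, sq_nonneg (‖z‖ - ‖w‖)]
    have h4 : (2 * R ^ 2 + 2 + ε ^ 2) * (1 + ‖w‖ ^ 2) ≤ A * (1 + ‖w‖ ^ 2) :=
      mul_le_mul_of_nonneg_right (by rw [hA]; linarith) hb.le
    nlinarith [sq_nonneg R, sq_nonneg ε, sq_nonneg ‖w‖,
      mul_nonneg (sq_nonneg R) (sq_nonneg ‖w‖), mul_nonneg (sq_nonneg ε) (sq_nonneg ‖w‖)]
  have h2 : 1 + ‖w‖ ^ 2 ≤ A * (‖z - w‖ ^ 2 + ε ^ 2) := by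
    have h2 := norm_sub_norm_le w z
    rw [norm_sub_rev w z] at h2
    have h3 : ‖w‖ ^ 2 ≤ 2 * ‖z‖ ^ 2 + 2 * ‖z - w‖ ^ 2 := by
      nlinarith [norm_nonneg (z - w), norm_nonneg z, norm_nonneg w, sq_nonneg (‖z‖ - ‖z - w‖)]
    have h4 : (2 + (1 + 2 * R ^ 2) / ε ^ 2) * (‖z - w‖ ^ 2 + ε ^ 2) ≤
        A * (‖z - w‖ ^ 2 + ε ^ 2) :=
      mul_le_mul_of_nonneg_right (by rw [hA]; nlinarith [sq_nonneg R, sq_nonneg ε]) ha.le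
    have h5 : (1 + 2 * R ^ 2) / ε ^ 2 * ε ^ 2 = 1 + 2 * R ^ 2 := by field_simp
    nlinarith [mul_nonneg hq (sq_nonneg ‖z - w‖), sq_nonneg ε]
  have l1 := Real.log_le_log ha h1
  have l2 := Real.log_le_log hb h2
  rw [Real.log_mul hA0.ne' hb.ne'] at l1
  rw [Real.log_mul hA0.ne' ha.ne'] at l2
  rw [logKernelReg, abs_le]
  constructor <;> linarith

theorem integrable_logKernelReg {ε : ℝ} (hε : 0 < ε) (z : ℂ) (ν : Measure ℂ)
    [IsFiniteMeasure ν] : Integrable (logKernelReg ε z) ν := by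
  obtain ⟨B, hB⟩ := exists_abs_logKernelReg_le hε ‖z‖
  refine Integrable.of_bound ?_ B (Eventually.of_forall fun w => hB z w le_rfl)
  exact ((stronglyMeasurable_logKernelReg ε).comp_measurable
    measurable_prodMk_left).aestronglyMeasurable

theorem integrable_cauchyKernelReg {ε : ℝ} (hε : 0 < ε) (z : ℂ) (ν : Measure ℂ)
    [IsFiniteMeasure ν] : Integrable (cauchyKernelReg ε z) ν :=
  integrable_of_tendsto_cocompact (continuous_cauchyKernelReg hε z) (tendsto_cauchyKernelReg ε z) ν

/-- With x = ε/‖z - w‖ the right side is (ε/‖z - w‖)^(3/2), at most √ε times the weight when ε ≤ 1.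
-/
theorem half_log_one_add_sq_le {x : ℝ} (hx : 0 ≤ x) : 1 / 2 * Real.log (1 + x ^ 2) ≤ x * √x := by
  rcases le_total x 1 with h | h
  · have h1 := Real.log_le_sub_one_of_pos (show 0 < 1 + x ^ 2 by positivity)
    have h2 : x ≤ √x := Real.le_sqrt_of_sq_le (by nlinarith)
    nlinarith [mul_le_mul_of_nonneg_left h2 hx]
  · have h1 := Real.log_le_sub_one_of_pos (show 0 < 1 + x by positivity)
    have h2 : 1 ≤ √x := Real.one_le_sqrt.2 h
    have h3 : Real.log (1 + x ^ 2) ≤ Real.log ((1 + x) ^ 2) :=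
      Real.log_le_log (by positivity) (by nlinarith)
    rw [Real.log_pow] at h3
    push_cast at h3
    nlinarith [mul_le_mul_of_nonneg_left h2 hx]

/-- Regularising only raises the kernel, so the regularised potentials are continuous majorants;
upper semicontinuity rests on this. -/
theorem logKernel_le_logKernelReg (ε : ℝ) {z w : ℂ} (h : w ≠ z) :
    logKernel z w ≤ logKernelReg ε z w := by
  have hr : 0 < ‖z - w‖ := norm_pos_iff.2 (sub_ne_zero.2 h.symm)
  have h1 : Real.log (‖z - w‖ ^ 2) ≤ Real.log (‖z - w‖ ^ 2 + ε ^ 2) :=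
    Real.log_le_log (by positivity) (by nlinarith [sq_nonneg ε])
  rw [Real.log_pow] at h1
  push_cast at h1
  unfold logKernel logKernelReg
  linarith

theorem enorm_sub_le_sqrt_mul_singKernel {E : Type*} [NormedAddCommGroup E] {ε : ℝ} {z w : ℂ}
    {a b : E} (hε : 0 < ε)
    (h : w ≠ z → ‖a - b‖ ≤ √ε / (‖z - w‖ * √‖z - w‖)) :
    ‖a - b‖ₑ ≤ ENNReal.ofReal (√ε) * singKernel z w := by
  by_cases hwz : w = z
  · have : ENNReal.ofReal (√ε) ≠ 0 := by simpa using hε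
    simp [hwz, singKernel, ENNReal.mul_top this]
  · have hr : 0 < ‖z - w‖ := norm_pos_iff.2 (sub_ne_zero.2 (Ne.symm hwz))
    rw [singKernel, ← ENNReal.ofReal_inv_of_pos (by positivity),
      ← ENNReal.ofReal_mul (by positivity), ← ofReal_norm]
    exact ENNReal.ofReal_le_ofReal (h hwz)

theorem enorm_logKernel_sub_le (ε : ℝ) (hε : 0 < ε) (hε1 : ε ≤ 1) (z w : ℂ) :
    ‖logKernel z w - logKernelReg ε z w‖ₑ ≤ ENNReal.ofReal (√ε) * singKernel z w := by
  refine enorm_sub_le_sqrt_mul_singKernel hε fun hwz => ?_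
  have hr : 0 < ‖z - w‖ := norm_pos_iff.2 (sub_ne_zero.2 (Ne.symm hwz))
  have h1 := logKernel_le_logKernelReg ε hwz
  have h2 := half_log_one_add_sq_le (x := ε / ‖z - w‖) (by positivity)
  have h3 : logKernelReg ε z w - logKernel z w = 1 / 2 * Real.log (1 + (ε / ‖z - w‖) ^ 2) := by
    have : 1 + (ε / ‖z - w‖) ^ 2 = (‖z - w‖ ^ 2 + ε ^ 2) / ‖z - w‖ ^ 2 := by field_simp
    rw [this, Real.log_div (by positivity) (by positivity), Real.log_pow]
    unfold logKernel logKernelReg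
    push_cast
    ring
  rw [norm_sub_rev, Real.norm_of_nonneg (by linarith), h3]
  refine h2.trans ?_
  rw [Real.sqrt_div hε.le, div_mul_div_comm]
  gcongr
  nlinarith [Real.sqrt_nonneg ε]

theorem enorm_cauchyKernel_sub_le (ε : ℝ) (hε : 0 < ε) (_ : ε ≤ 1) (z w : ℂ) :
    ‖(z - w)⁻¹ - cauchyKernelReg ε z w‖ₑ ≤ ENNReal.ofReal (√ε) * singKernel z w := by
  refine enorm_sub_le_sqrt_mul_singKernel hε fun hwz => ?_
  have hzw : z - w ≠ 0 := sub_ne_zero.2 (Ne.symm hwz)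
  have hr : 0 < ‖z - w‖ := norm_pos_iff.2 hzw
  set r := ‖z - w‖ with hrdef
  have hD : ((r ^ 2 + ε ^ 2 : ℝ) : ℂ) ≠ 0 := by
    rw [Ne, Complex.ofReal_eq_zero]; positivity
  have h1 : (z - w)⁻¹ - cauchyKernelReg ε z w =
      ((ε ^ 2 : ℝ) : ℂ) / ((z - w) * ((r ^ 2 + ε ^ 2 : ℝ) : ℂ)) := by
    have h2 : (z - w) * (starRingEnd ℂ) (z - w) = ((r ^ 2 : ℝ) : ℂ) := by
      rw [Complex.mul_conj, Complex.normSq_eq_norm_sq]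
    unfold cauchyKernelReg
    rw [← hrdef, inv_eq_one_div, div_sub_div _ _ hzw hD, h2]
    push_cast
    ring_nf
  rw [h1, norm_div, norm_mul, Complex.norm_real, Complex.norm_real,
    Real.norm_of_nonneg (by positivity), Real.norm_of_nonneg (by positivity), ← hrdef]
  rw [div_le_div_iff₀ (by positivity) (by positivity)]
  -- With ε = a² and r = b² this reads a⁴b ≤ ab⁴ + a⁵, and one of the two terms suffices according
  -- to which of a and b is larger.
  have h3 : ε ^ 2 * √r ≤ √ε * (r ^ 2 + ε ^ 2) := by
    obtain ⟨a, ha, rfl⟩ : ∃ a, 0 < a ∧ ε = a ^ 2 :=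
      ⟨√ε, Real.sqrt_pos.2 hε, (Real.sq_sqrt hε.le).symm⟩
    obtain ⟨b, hb, hb'⟩ : ∃ b, 0 < b ∧ r = b ^ 2 :=
      ⟨√r, Real.sqrt_pos.2 hr, (Real.sq_sqrt hr.le).symm⟩
    rw [hb', Real.sqrt_sq ha.le, Real.sqrt_sq hb.le]
    rcases le_total a b with h | h
    · have : a ^ 3 ≤ b ^ 3 := pow_le_pow_left₀ ha.le h 3
      nlinarith [mul_le_mul_of_nonneg_left this (show 0 ≤ a * b by positivity), pow_pos ha 5]
    · nlinarith [mul_le_mul_of_nonneg_left h (show 0 ≤ a ^ 4 by positivity),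
        show 0 ≤ a * b ^ 4 by positivity]
  calc ε ^ 2 * (r * √r) = r * (ε ^ 2 * √r) := by ring
    _ ≤ r * (√ε * (r ^ 2 + ε ^ 2)) := by gcongr
    _ = _ := by ring

theorem integrable_logKernel {ν : Measure ℂ} [IsFiniteMeasure ν] {z : ℂ}
    (hz : singPotential ν z < ⊤) : Integrable (logKernel z) ν :=
  integrable_of_enorm_sub_le stronglyMeasurable_logKernel
    (fun _ h _ z ν _ => integrable_logKernelReg h z ν) enorm_logKernel_sub_le hz

theorem integrable_cauchyKernel {ν : Measure ℂ} [IsFiniteMeasure ν] {z : ℂ}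
    (hz : singPotential ν z < ⊤) : Integrable (fun w => (z - w)⁻¹) ν :=
  integrable_of_enorm_sub_le (K := fun z w : ℂ => (z - w)⁻¹) stronglyMeasurable_cauchyKernel
    (fun _ h _ z ν _ => integrable_cauchyKernelReg h z ν) enorm_cauchyKernel_sub_le hz

/-! ### Convergence and semicontinuity of potentials. -/

theorem tendstoInMeasure_logPotential {ν : ℕ → Measure ℂ} {μ : Measure ℂ}
    (h : VagueTendsto ν μ) (hν : ∀ n, ν n Set.univ ≤ 1) (hμ : μ Set.univ ≤ 1)
    {m : Measure ℂ} [IsFiniteMeasure m] (hm : m ≤ volume) :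
    TendstoInMeasure m (fun n => logPotential (ν n)) atTop (logPotential μ) := by
  refine tendstoInMeasure_integral_kernel (K := logKernel) (Kr := logKernelReg)
    stronglyMeasurable_logKernel stronglyMeasurable_logKernelReg
    (fun _ h _ z ν _ => integrable_logKernelReg h z ν) enorm_logKernel_sub_le hν hμ
    (fun ε hε hε1 z => ?_) hm
  exact h.tendsto_integral_real hν hμ (continuous_logKernelReg_right hε z)
    (tendsto_logKernelReg hε hε1 z)

theorem tendstoInMeasure_cauchyTransform {ν : ℕ → Measure ℂ} {μ : Measure ℂ}
    (h : VagueTendsto ν μ) (hν : ∀ n, ν n Set.univ ≤ 1) (hμ : μ Set.univ ≤ 1)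
    {m : Measure ℂ} [IsFiniteMeasure m] (hm : m ≤ volume) :
    TendstoInMeasure m (fun n => cauchyTransform (ν n)) atTop (cauchyTransform μ) :=
  tendstoInMeasure_integral_kernel (K := fun z w : ℂ => (z - w)⁻¹)
    stronglyMeasurable_cauchyKernel stronglyMeasurable_cauchyKernelReg
    (fun _ h _ z ν _ => integrable_cauchyKernelReg h z ν) enorm_cauchyKernel_sub_le hν hμ
    (fun ε hε _ z => h.tendsto_integral_complex hν hμ
      (continuous_cauchyKernelReg hε z) (tendsto_cauchyKernelReg ε z)) hm

theorem measurable_logPotential (ν : Measure ℂ) [SFinite ν] : Measurable (logPotential ν) :=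
  (stronglyMeasurable_logKernel.integral_prod_right (ν := ν)).measurable

theorem continuous_integral_logKernelReg {ε : ℝ} (hε : 0 < ε) (ν : Measure ℂ)
    [IsFiniteMeasure ν] : Continuous fun z => ∫ w, logKernelReg ε z w ∂ν := by
  rw [continuous_iff_continuousAt]
  intro x
  obtain ⟨B, hB⟩ := exists_abs_logKernelReg_le hε (‖x‖ + 1)
  refine continuousAt_of_dominated (bound := fun _ => B) ?_ ?_ (integrable_const _) ?_
  · exact Eventually.of_forall fun z => (integrable_logKernelReg hε z ν).1
  · filter_upwards [Metric.ball_mem_nhds x one_pos] with z hz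
    refine Eventually.of_forall fun w => hB z w ?_
    have h1 := norm_sub_norm_le z x
    have h2 : ‖z - x‖ < 1 := by simpa [dist_eq_norm] using hz
    linarith
  · exact Eventually.of_forall fun w =>
      ((continuous_logKernelReg hε).comp (Continuous.prodMk_left w)).continuousAt

/-- Logarithmic potentials are upper semicontinuous. -/
theorem eventually_logPotential_lt {ν : Measure ℂ} [IsFiniteMeasure ν] {x : ℂ}
    (hx : singPotential ν x < ⊤) {t : ℝ} (ht : logPotential ν x < t) :
    ∀ᶠ y in 𝓝 x, singPotential ν y < ⊤ → logPotential ν y < t := by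
  -- At `x` the regularisation error is at most √ε times a finite number, so some regularised
  -- potential is still below `t` at `x`, hence below `t` nearby by continuity.
  obtain ⟨ε, hε, hε1, hεt⟩ : ∃ ε, 0 < ε ∧ ε ≤ 1 ∧ ∫ w, logKernelReg ε x w ∂ν < t := by
    have h1 : Tendsto (fun ε : ℝ => √ε * (singPotential ν x).toReal) (𝓝[>] 0) (𝓝 0) := by
      have : Tendsto (fun ε : ℝ => √ε * (singPotential ν x).toReal) (𝓝 0)
          (𝓝 (√0 * (singPotential ν x).toReal)) :=
        (Continuous.mul Real.continuous_sqrt continuous_const).tendsto 0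
      rw [Real.sqrt_zero, zero_mul] at this
      exact this.mono_left nhdsWithin_le_nhds
    obtain ⟨ε, h2, hε, hε1⟩ := ((h1.eventually (gt_mem_nhds (sub_pos.2 ht))).and
      (Ioc_mem_nhdsGT (zero_lt_one' ℝ))).exists
    refine ⟨ε, hε, hε1, ?_⟩
    have h3 := enorm_integral_sub_le stronglyMeasurable_logKernel
      (fun _ h _ z ν _ => integrable_logKernelReg h z ν) enorm_logKernel_sub_le hx hε hε1
    rw [← ofReal_norm, ← ENNReal.ofReal_toReal hx.ne, ← ENNReal.ofReal_mul (by positivity),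
      ENNReal.ofReal_le_ofReal_iff (by positivity), Real.norm_eq_abs, abs_le] at h3
    have h4 := h3.1
    unfold logPotential at h2
    linarith
  filter_upwards [(continuous_integral_logKernelReg hε ν).continuousAt.eventually
    (gt_mem_nhds hεt)] with y hy hys
  refine lt_of_le_of_lt ?_ hy
  refine integral_mono_ae (integrable_logKernel hys) (integrable_logKernelReg hε y ν) ?_
  filter_upwards [ae_ne_of_singPotential_lt_top hys] with w hw
  exact logKernel_le_logKernelReg ε hw

/-! ### The Laplacian, and recovery of a measure from its potential. -/

/-- The Laplacian of a function on the plane. -/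
noncomputable def planeLaplacian (φ : ℂ → ℝ) (z : ℂ) : ℝ :=
  fderiv ℝ (fun x => fderiv ℝ φ x 1) z 1 + fderiv ℝ (fun x => fderiv ℝ φ x Complex.I) z Complex.I

/-- The Laplacian of the regularised logarithm. -/
noncomputable def logLaplacian (ε : ℝ) (z : ℂ) : ℝ := 2 * ε ^ 2 / (‖z‖ ^ 2 + ε ^ 2) ^ 2

theorem ContDiff.fderiv_apply_const {φ : ℂ → ℝ} (hφ : ContDiff ℝ ∞ φ) (v : ℂ) :
    ContDiff ℝ ∞ fun x => fderiv ℝ φ x v :=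
  (hφ.fderiv_right (m := ∞) (by simp)).clm_apply contDiff_const

theorem HasCompactSupport.fderiv_apply_const {φ : ℂ → ℝ} (hφ : HasCompactSupport φ) (v : ℂ) :
    HasCompactSupport fun x => fderiv ℝ φ x v :=
  hφ.fderiv_apply ℝ v

theorem tsupport_fderiv_apply_const_subset (φ : ℂ → ℝ) (v : ℂ) :
    tsupport (fun x => fderiv ℝ φ x v) ⊆ tsupport φ :=
  tsupport_fderiv_apply_subset ℝ v

theorem hasFDerivAt_norm_sub_sq (w z : ℂ) :
    HasFDerivAt (fun x : ℂ => ‖x - w‖ ^ 2) ((2 : ℝ) • innerSL ℝ (z - w)) z := by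
  have h := (hasStrictFDerivAt_norm_sq (z - w)).hasFDerivAt.comp z ((hasFDerivAt_id z).sub_const w)
  refine h.congr_fderiv ?_
  ext v; simp

theorem fderiv_logKernelReg {ε : ℝ} (hε : 0 < ε) (w z v : ℂ) :
    fderiv ℝ (fun x => logKernelReg ε x w) z v = inner ℝ (z - w) v / (‖z - w‖ ^ 2 + ε ^ 2) := by
  have h1 := (((hasFDerivAt_norm_sub_sq w z).add_const (ε ^ 2)).log
    (by positivity)).const_mul (1 / 2)
  have h2 := h1.sub_const (1 / 2 * Real.log (1 + ‖w‖ ^ 2))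
  have h3 : HasFDerivAt (fun x => logKernelReg ε x w) _ z := h2
  rw [h3.fderiv]
  simp
  field_simp
  ring

theorem contDiff_logKernelReg {ε : ℝ} (hε : 0 < ε) (w : ℂ) :
    ContDiff ℝ ∞ fun x => logKernelReg ε x w := by
  unfold logKernelReg
  refine (contDiff_const.mul (ContDiff.log ?_ fun x => by positivity)).sub contDiff_const
  exact ((contDiff_id.sub contDiff_const).norm_sq ℝ).add contDiff_const

theorem planeLaplacian_logKernelReg {ε : ℝ} (hε : 0 < ε) (w z : ℂ) :
    planeLaplacian (fun x => logKernelReg ε x w) z = logLaplacian ε (z - w) := by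
  have hN : ‖z - w‖ ^ 2 + ε ^ 2 ≠ 0 := by positivity
  have key (v : ℂ) : fderiv ℝ (fun x => fderiv ℝ (fun y => logKernelReg ε y w) x v) z v =
      (‖v‖ ^ 2 * (‖z - w‖ ^ 2 + ε ^ 2) - 2 * (inner ℝ (z - w) v) ^ 2) /
        (‖z - w‖ ^ 2 + ε ^ 2) ^ 2 := by
    simp_rw [fderiv_logKernelReg hε w _ v]
    have h1 : HasFDerivAt (fun x : ℂ => (inner ℝ (x - w) v : ℝ)) (innerSL ℝ v) z := by
      have h2 := (innerSL ℝ v).hasFDerivAt (x := z - w)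
      have h3 := h2.comp z ((hasFDerivAt_id z).sub_const w)
      refine (h3.congr_of_eventuallyEq (Eventually.of_forall fun x => ?_)).congr_fderiv ?_
      · simp [real_inner_comm]
      · ext; simp
    have h2 := ((hasFDerivAt_norm_sub_sq w z).add_const (ε ^ 2))
    have h3 := h1.mul ((hasDerivAt_inv hN).comp_hasFDerivAt z h2)
    have h4 : HasFDerivAt (fun x : ℂ => inner ℝ (x - w) v / (‖x - w‖ ^ 2 + ε ^ 2)) _ z := h3
    rw [h4.fderiv]
    simp only [add_apply, smul_apply, innerSL_apply_apply, smul_eq_mul,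
      real_inner_self_eq_norm_sq, Function.comp_apply]
    field_simp
    ring
  unfold planeLaplacian
  rw [key, key, logLaplacian, ← add_div]
  congr 1
  have h1 : (inner ℝ (z - w) 1 : ℝ) = (z - w).re := by simp [Complex.inner]
  have h2 : (inner ℝ (z - w) Complex.I : ℝ) = (z - w).im := by
    simp [Complex.inner]; ring
  have h3 : ‖z - w‖ ^ 2 = (z - w).re ^ 2 + (z - w).im ^ 2 := by
    rw [← Complex.normSq_eq_norm_sq, Complex.normSq_apply]; ring
  rw [h1, h2, h3]
  simp
  ring

/-- Two integrations by parts in each coordinate direction; only `φ` needs compact support. -/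
theorem integral_mul_planeLaplacian {f φ : ℂ → ℝ} (hf : ContDiff ℝ ∞ f) (hφ : ContDiff ℝ ∞ φ)
    (hs : HasCompactSupport φ) :
    ∫ z, f z * planeLaplacian φ z = ∫ z, planeLaplacian f z * φ z := by
  have ibp (g ψ : ℂ → ℝ) (hg : ContDiff ℝ ∞ g) (hψ : ContDiff ℝ ∞ ψ) (hψs : HasCompactSupport ψ)
      (v : ℂ) : ∫ z, g z * fderiv ℝ ψ z v = -∫ z, fderiv ℝ g z v * ψ z := by
    refine integral_mul_fderiv_eq_neg_fderiv_mul_of_integrable ?_ ?_ ?_ ?_ ?_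
    · exact ((hg.fderiv_apply_const v).continuous.mul
        hψ.continuous).integrable_of_hasCompactSupport hψs.mul_left
    · exact (hg.continuous.mul
        (hψ.fderiv_apply_const v).continuous).integrable_of_hasCompactSupport
        (hψs.fderiv_apply_const v).mul_left
    · exact (hg.continuous.mul hψ.continuous).integrable_of_hasCompactSupport hψs.mul_left
    · exact fun x _ => (hg.differentiable (by simp)).differentiableAt
    · exact fun x _ => (hψ.differentiable (by simp)).differentiableAt
  have twice (v : ℂ) : ∫ z, f z * fderiv ℝ (fun x => fderiv ℝ φ x v) z v =
      ∫ z, fderiv ℝ (fun x => fderiv ℝ f x v) z v * φ z := by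
    rw [ibp f _ hf (hφ.fderiv_apply_const v) (hs.fderiv_apply_const v) v,
      ibp _ φ (hf.fderiv_apply_const v) hφ hs v, neg_neg]
  have i1 (v : ℂ) : Integrable fun z => f z * fderiv ℝ (fun x => fderiv ℝ φ x v) z v :=
    (hf.continuous.mul ((hφ.fderiv_apply_const v).fderiv_apply_const
      v).continuous).integrable_of_hasCompactSupport
      ((hs.fderiv_apply_const v).fderiv_apply_const v).mul_left
  have i2 (v : ℂ) : Integrable fun z => fderiv ℝ (fun x => fderiv ℝ f x v) z v * φ z :=
    (((hf.fderiv_apply_const v).fderiv_apply_const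
      v).continuous.mul hφ.continuous).integrable_of_hasCompactSupport hs.mul_left
  unfold planeLaplacian
  simp_rw [mul_add, add_mul]
  rw [integral_add (i1 _) (i1 _), integral_add (i2 _) (i2 _), twice, twice]

theorem continuous_planeLaplacian {φ : ℂ → ℝ} (hφ : ContDiff ℝ ∞ φ) :
    Continuous (planeLaplacian φ) :=
  (((hφ.fderiv_apply_const _).fderiv_apply_const _).continuous).add
    (((hφ.fderiv_apply_const _).fderiv_apply_const _).continuous)

theorem planeLaplacian_eq_zero_of_notMem_tsupport {φ : ℂ → ℝ} {z : ℂ} (hz : z ∉ tsupport φ) :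
    planeLaplacian φ z = 0 := by
  have h (v : ℂ) : fderiv ℝ (fun x => fderiv ℝ φ x v) z v = 0 := by
    by_contra h0
    exact hz (tsupport_fderiv_apply_const_subset φ v
      (tsupport_fderiv_apply_const_subset _ v (subset_tsupport _ h0)))
  rw [planeLaplacian, h, h, add_zero]

theorem hasCompactSupport_planeLaplacian {φ : ℂ → ℝ} (hs : HasCompactSupport φ) :
    HasCompactSupport (planeLaplacian φ) :=
  HasCompactSupport.intro hs.isCompact fun _ hz => planeLaplacian_eq_zero_of_notMem_tsupport hz

theorem integrable_planeLaplacian {φ : ℂ → ℝ} (hφ : ContDiff ℝ ∞ φ) (hs : HasCompactSupport φ) :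
    Integrable (planeLaplacian φ) :=
  (continuous_planeLaplacian hφ).integrable_of_hasCompactSupport
    (hasCompactSupport_planeLaplacian hs)

theorem integral_planeLaplacian {φ : ℂ → ℝ} (hφ : ContDiff ℝ ∞ φ) (hs : HasCompactSupport φ) :
    ∫ z, planeLaplacian φ z = 0 := by
  have := integral_mul_planeLaplacian (f := fun _ => 1) contDiff_const hφ hs
  simpa [planeLaplacian] using this

theorem integrable_logLaplacian_one : Integrable (logLaplacian 1) := by
  have h := integrable_rpow_neg_one_add_norm_sq (E := ℂ) (μ := volume) (r := 4)
    (by rw [Complex.finrank_real_complex]; norm_num)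
  refine (h.const_mul 2).congr (Eventually.of_forall fun z => ?_)
  simp only [logLaplacian]
  rw [show (-4 / 2 : ℝ) = -(2 : ℕ) by norm_num, Real.rpow_neg (by positivity), Real.rpow_natCast,
    add_comm, one_pow, mul_one, div_eq_mul_inv]

/-- Positivity is all that is used of this normalising constant, which is cancelled later. -/
theorem integral_logLaplacian_one_pos : 0 < ∫ z, logLaplacian 1 z := by
  have hpos : ∀ z, 0 < logLaplacian 1 z := fun z => by unfold logLaplacian; positivity
  rw [integral_pos_iff_support_of_nonneg (fun z => (hpos z).le) integrable_logLaplacian_one]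
  rw [show Function.support (logLaplacian 1) = Set.univ from
    Set.eq_univ_of_forall fun z => (hpos z).ne']
  simp

/-- By scaling, `logLaplacian ε` is ε⁻² times `logLaplacian 1` at z/ε: an approximate identity up to
a constant factor. -/
theorem integral_logLaplacian_sub_mul {ε : ℝ} (hε : 0 < ε) (φ : ℂ → ℝ) (w : ℂ) :
    ∫ z, logLaplacian ε (z - w) * φ z = ∫ x, logLaplacian 1 x * φ (w + ε • x) := by
  have h1 := Measure.integral_comp_smul (volume : Measure ℂ)
    (fun y => logLaplacian 1 (ε⁻¹ • y) * φ (w + y)) ε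
  simp only [smul_smul, inv_mul_cancel₀ hε.ne', one_smul] at h1
  rw [h1, ← integral_sub_right_eq_self (fun z => |(ε ^ Module.finrank ℝ ℂ)⁻¹| •
    (logLaplacian 1 (ε⁻¹ • z) * φ (w + z))) w |>.trans (integral_smul _ _)]
  refine integral_congr_ae (Eventually.of_forall fun z => ?_)
  simp only [logLaplacian, Complex.finrank_real_complex, norm_smul, smul_eq_mul,
    add_sub_cancel]
  rw [abs_of_pos (by positivity), Real.norm_of_nonneg (by positivity : 0 ≤ ε⁻¹), ← mul_assoc]
  congr 1
  field_simp

theorem continuous_logLaplacian {ε : ℝ} (hε : 0 < ε) : Continuous (logLaplacian ε) := by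
  unfold logLaplacian
  exact Continuous.div continuous_const (by fun_prop) fun x => by positivity

theorem tendsto_integral_logLaplacian_one_mul {φ : ℂ → ℝ} (hφ : Continuous φ)
    (hs : HasCompactSupport φ) (ν : Measure ℂ) [IsFiniteMeasure ν] :
    Tendsto (fun ε : ℝ => ∫ w, (∫ x, logLaplacian 1 x * φ (w + ε • x)) ∂ν) (𝓝[>] 0)
      (𝓝 ((∫ x, logLaplacian 1 x) * ∫ w, φ w ∂ν)) := by
  obtain ⟨M, hM⟩ := hs.exists_bound_of_continuous hφ
  have hpos : ∀ z, 0 ≤ logLaplacian 1 z := fun z => by unfold logLaplacian; positivity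
  have hle (w x : ℂ) (ε : ℝ) :
      ‖logLaplacian 1 x * φ (w + ε • x)‖ ≤ logLaplacian 1 x * M := by
    rw [norm_mul, Real.norm_of_nonneg (hpos x)]
    exact mul_le_mul_of_nonneg_left (hM _) (hpos x)
  rw [← integral_const_mul]
  refine tendsto_integral_filter_of_dominated_convergence
    (fun _ => (∫ x, logLaplacian 1 x) * M) ?_ ?_ (integrable_const _) ?_
  · refine Eventually.of_forall fun ε => StronglyMeasurable.aestronglyMeasurable ?_
    have hc : Continuous (Function.uncurry fun w x => logLaplacian 1 x * φ (w + ε • x)) := by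
      have := continuous_logLaplacian one_pos
      unfold Function.uncurry
      fun_prop
    exact hc.stronglyMeasurable.integral_prod_right
  · refine Eventually.of_forall fun ε => Eventually.of_forall fun w => ?_
    rw [← integral_mul_const]
    exact norm_integral_le_of_norm_le (integrable_logLaplacian_one.mul_const M)
      (Eventually.of_forall fun x => hle w x ε)
  · refine Eventually.of_forall fun w => ?_
    rw [← integral_mul_const]
    refine tendsto_integral_filter_of_dominated_convergence (fun x => logLaplacian 1 x * M)
      ?_ ?_ (integrable_logLaplacian_one.mul_const M) ?_
    · refine Eventually.of_forall fun ε => Continuous.aestronglyMeasurable ?_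
      have := continuous_logLaplacian one_pos
      fun_prop
    · exact Eventually.of_forall fun ε => Eventually.of_forall fun x => hle w x ε
    · refine Eventually.of_forall fun x => ?_
      have : Continuous fun ε : ℝ => logLaplacian 1 x * φ (w + ε • x) := by fun_prop
      have h := this.tendsto 0
      simp only [zero_smul, add_zero] at h
      exact h.mono_left nhdsWithin_le_nhds

/-- Fubini, then the Laplacian moves from `φ` onto the smooth kernel. -/
theorem integral_planeLaplacian_mul_integral_logKernelReg {φ : ℂ → ℝ} (hφ : ContDiff ℝ ∞ φ)
    (hs : HasCompactSupport φ) (ν : Measure ℂ) [IsFiniteMeasure ν] {ε : ℝ} (hε : 0 < ε) :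
    ∫ z, planeLaplacian φ z * ∫ w, logKernelReg ε z w ∂ν =
      ∫ w, (∫ x, logLaplacian 1 x * φ (w + ε • x)) ∂ν := by
  simp_rw [← integral_const_mul]
  rw [integral_integral_swap]
  · refine integral_congr_ae (Eventually.of_forall fun w => ?_)
    simp only
    rw [← integral_logLaplacian_sub_mul hε]
    simp_rw [← planeLaplacian_logKernelReg hε]
    rw [← integral_mul_planeLaplacian (contDiff_logKernelReg hε w) hφ hs]
    simp_rw [mul_comm]
  · obtain ⟨R, hR⟩ := hs.isCompact.isBounded.exists_norm_le
    obtain ⟨B, hB⟩ := exists_abs_logKernelReg_le hε R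
    have h1 : Integrable (fun p : ℂ × ℂ => ‖planeLaplacian φ p.1‖ * B) (volume.prod ν) :=
      ((integrable_planeLaplacian hφ hs).norm.mul_const B).comp_fst ν
    refine h1.mono' ?_ (Eventually.of_forall fun p => ?_)
    · exact (((continuous_planeLaplacian hφ).comp continuous_fst).mul
        (continuous_logKernelReg hε)).aestronglyMeasurable
    · simp only [Function.uncurry, norm_mul]
      by_cases hp : p.1 ∈ tsupport φ
      · exact mul_le_mul_of_nonneg_left (hB _ _ (hR _ hp)) (norm_nonneg _)
      · simp [planeLaplacian_eq_zero_of_notMem_tsupport hp]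

/-- The distributional Poisson equation: ΔU_ν is a positive constant times ν. It follows from the
regularised identity as ε → 0, the error on the support of `φ` being O(√ε) in L¹. -/
theorem integrable_planeLaplacian_mul_logPotential {φ : ℂ → ℝ} (hφ : ContDiff ℝ ∞ φ)
    (hs : HasCompactSupport φ) (ν : Measure ℂ) [IsFiniteMeasure ν] :
    Integrable (fun z => planeLaplacian φ z * logPotential ν z) ∧
    ∫ z, planeLaplacian φ z * logPotential ν z = (∫ x, logLaplacian 1 x) * ∫ w, φ w ∂ν := by
  obtain ⟨M, hM⟩ := (hasCompactSupport_planeLaplacian hs).exists_bound_of_continuous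
    (continuous_planeLaplacian hφ)
  obtain ⟨C, hC, hsing⟩ := exists_lintegral_singPotential_le
  have hS : MeasurableSet (tsupport φ) := (isClosed_tsupport φ).measurableSet
  set A := ∫⁻ z in tsupport φ, singPotential ν z with hA
  have hAt : A < ⊤ := by
    refine (hsing (volume.restrict (tsupport φ)) ν inferInstance inferInstance
      Measure.restrict_le_self).trans_lt ?_
    rw [Measure.restrict_apply_univ]
    have := hs.isCompact.measure_lt_top (μ := volume)
    finiteness
  have herr {ε : ℝ} (hε : 0 < ε) (hε1 : ε ≤ 1) :
      ∫⁻ z, ‖planeLaplacian φ z * logPotential ν z -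
        planeLaplacian φ z * ∫ w, logKernelReg ε z w ∂ν‖ₑ ≤
        ENNReal.ofReal (√ε) * (ENNReal.ofReal M * A) := by
    have h1 : ∀ᵐ z, ‖planeLaplacian φ z * logPotential ν z -
        planeLaplacian φ z * ∫ w, logKernelReg ε z w ∂ν‖ₑ ≤
        (tsupport φ).indicator
          (fun z => ENNReal.ofReal M * (ENNReal.ofReal (√ε) * singPotential ν z)) z := by
      filter_upwards [ae_singPotential_lt_top ν] with z hz
      by_cases hp : z ∈ tsupport φ
      · rw [Set.indicator_of_mem hp, ← mul_sub, enorm_mul]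
        refine mul_le_mul' ?_ (enorm_integral_sub_le stronglyMeasurable_logKernel
          (fun _ h _ z ν _ => integrable_logKernelReg h z ν) enorm_logKernel_sub_le hz hε hε1)
        rw [← ofReal_norm]
        exact ENNReal.ofReal_le_ofReal (hM z)
      · simp [planeLaplacian_eq_zero_of_notMem_tsupport hp]
    refine (lintegral_mono_ae h1).trans ?_
    rw [lintegral_indicator hS, lintegral_const_mul' _ _ ENNReal.ofReal_ne_top,
      lintegral_const_mul' _ _ ENNReal.ofReal_ne_top, mul_left_comm]
  have hreg {ε : ℝ} (hε : 0 < ε) :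
      Integrable fun z => planeLaplacian φ z * ∫ w, logKernelReg ε z w ∂ν :=
    ((continuous_planeLaplacian hφ).mul
      (continuous_integral_logKernelReg hε ν)).integrable_of_hasCompactSupport
      (hasCompactSupport_planeLaplacian hs).mul_right
  have hint : Integrable (fun z => planeLaplacian φ z * logPotential ν z) := by
    have hm : AEStronglyMeasurable (fun z => planeLaplacian φ z * logPotential ν z) :=
      ((continuous_planeLaplacian hφ).measurable.mul
        (measurable_logPotential ν)).aestronglyMeasurable
    have h1 : Integrable fun z => planeLaplacian φ z * logPotential ν z -
        planeLaplacian φ z * ∫ w, logKernelReg 1 z w ∂ν :=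
      ⟨hm.sub (hreg one_pos).1, (herr one_pos le_rfl).trans_lt (by finiteness)⟩
    exact (h1.add (hreg one_pos)).congr (Eventually.of_forall fun w => by simp)
  refine ⟨hint, ?_⟩
  refine tendsto_nhds_unique ?_ (tendsto_integral_logLaplacian_one_mul hφ.continuous hs ν)
  rw [tendsto_iff_edist_tendsto_0]
  have h0 : Tendsto (fun ε : ℝ => ENNReal.ofReal (√ε) * (ENNReal.ofReal M * A)) (𝓝[>] 0)
      (𝓝 0) := by
    have h1 : Tendsto (fun ε : ℝ => ENNReal.ofReal (√ε)) (𝓝[>] 0) (𝓝 0) := by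
      have : Tendsto (fun ε : ℝ => ENNReal.ofReal (√ε)) (𝓝 0) (𝓝 (ENNReal.ofReal (√0))) :=
        (ENNReal.continuous_ofReal.comp Real.continuous_sqrt).tendsto 0
      rw [Real.sqrt_zero, ENNReal.ofReal_zero] at this
      exact this.mono_left nhdsWithin_le_nhds
    have h2 := ENNReal.Tendsto.mul_const (b := ENNReal.ofReal M * A) h1
      (Or.inr (by finiteness))
    rwa [zero_mul] at h2
  refine tendsto_of_tendsto_of_tendsto_of_le_of_le' tendsto_const_nhds h0
    (Eventually.of_forall fun _ => zero_le) ?_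
  filter_upwards [Ioc_mem_nhdsGT (zero_lt_one' ℝ)] with ε hε
  rw [← integral_planeLaplacian_mul_integral_logKernelReg hφ hs ν hε.1, edist_comm,
    edist_eq_enorm_sub, ← integral_sub hint (hreg hε.1)]
  exact (enorm_integral_le_lintegral_enorm _).trans (herr hε.1 hε.2)

/-- Measures are locally determined by their logarithmic potentials, up to additive constants. -/
theorem integral_eq_of_logPotential_ae_eq {ν ν' : Measure ℂ} [IsFiniteMeasure ν]
    [IsFiniteMeasure ν'] {c : ℝ} {φ : ℂ → ℝ} (hφ : ContDiff ℝ ∞ φ) (hs : HasCompactSupport φ)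
    (h : ∀ᵐ z, z ∈ tsupport φ → logPotential ν z = logPotential ν' z + c) :
    ∫ z, φ z ∂ν = ∫ z, φ z ∂ν' := by
  obtain ⟨i1, e1⟩ := integrable_planeLaplacian_mul_logPotential hφ hs ν
  obtain ⟨i2, e2⟩ := integrable_planeLaplacian_mul_logPotential hφ hs ν'
  refine mul_left_cancel₀ integral_logLaplacian_one_pos.ne' ?_
  rw [← e1, ← e2]
  have h3 : ∫ z, planeLaplacian φ z * logPotential ν z =
      ∫ z, (planeLaplacian φ z * logPotential ν' z + planeLaplacian φ z * c) := by
    refine integral_congr_ae ?_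
    filter_upwards [h] with z hz
    by_cases hp : z ∈ tsupport φ
    · rw [hz hp, mul_add]
    · simp [planeLaplacian_eq_zero_of_notMem_tsupport hp]
  rw [h3, integral_add i2 ((integrable_planeLaplacian hφ hs).mul_const c), integral_mul_const,
    integral_planeLaplacian hφ hs, zero_mul, add_zero]

/-- A point near which the logarithmic potential is almost everywhere constant is not in the
support of the measure. -/
theorem notMem_support_of_logPotential_ae_eq_const {ν : Measure ℂ} [IsFiniteMeasure ν] {c : ℝ}
    {O : Set ℂ} {x : ℂ} (hO : O ∈ 𝓝 x) (h : ∀ᵐ z, z ∈ O → logPotential ν z = c) :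
    x ∉ ν.support := by
  obtain ⟨r, hr, hrO⟩ := Metric.nhds_basis_closedBall.mem_iff.1 hO
  let b : ContDiffBump x := ⟨r / 2, r, by positivity, by linarith⟩
  have h1 := integral_eq_of_logPotential_ae_eq (ν := ν) (ν' := 0) (c := c) (φ := b) b.contDiff
    b.hasCompactSupport (by
      filter_upwards [h] with z hz hzb
      rw [b.tsupport_eq] at hzb
      rw [hz (hrO hzb)]
      simp [logPotential])
  rw [integral_zero_measure] at h1
  have hi : Integrable b ν := b.continuous.integrable_of_hasCompactSupport b.hasCompactSupport
  rw [integral_eq_zero_iff_of_nonneg (fun z => b.nonneg) hi] at h1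
  rw [Measure.notMem_support_iff_exists]
  refine ⟨Metric.ball x r, Metric.ball_mem_nhds _ hr, ?_⟩
  refine measure_mono_null (fun z hz => ?_) h1
  exact (b.pos_of_mem_ball hz).ne'

/-! ### Truncated potentials on lines and on squares. -/

/-- A function with integrable derivative `G`, vanishing where the function exceeds `τ`: the
truncation `max g τ` is constant. -/
theorem max_eq_max_of_integral_eq_sub {a b τ : ℝ} {g G : ℝ → ℝ}
    (hG : IntegrableOn G (Set.Icc a b))
    (hg : ∀ s ∈ Set.Icc a b, ∀ t ∈ Set.Icc a b, g t - g s = ∫ r in s..t, G r)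
    (h0 : ∀ᵐ r, r ∈ Set.Icc a b → τ < g r → G r = 0) :
    ∀ s ∈ Set.Icc a b, ∀ t ∈ Set.Icc a b, max (g s) τ = max (g t) τ := by
  have hcont : ContinuousOn g (Set.Icc a b) := by
    intro s hs
    have hab : a ≤ b := hs.1.trans hs.2
    rw [← Set.uIcc_of_le hab] at hG
    have h1 := intervalIntegral.continuousOn_primitive_interval' hG.intervalIntegrable
      (a := s) (by rwa [Set.uIcc_of_le hab])
    rw [Set.uIcc_of_le hab] at h1
    refine ((h1.add (continuousOn_const (c := g s))).congr fun t ht => ?_) s hs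
    change g t = (∫ x in s..t, G x) + g s
    rw [← hg s hs t ht, sub_add_cancel]
  have key : ∀ s ∈ Set.Icc a b, τ < g s → ∀ t ∈ Set.Icc a b, g t = g s := by
    intro s hs hsτ t ht
    have hpc : PreconnectedSpace (Set.Icc a b) :=
      isPreconnected_iff_preconnectedSpace.1 isPreconnected_Icc
    have hgc : Continuous fun x : Set.Icc a b => g x := continuousOn_iff_continuous_domRestrict.1 hcont
    -- Where `g` exceeds `τ` its derivative vanishes, so `g` is locally constant there and this
    -- level set is open as well as closed in the interval.
    have hclopen : IsClopen {x : Set.Icc a b | g x = g s} := by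
      refine ⟨isClosed_eq hgc continuous_const, ?_⟩
      rw [Metric.isOpen_iff]
      intro x hx
      have hx' : g x = g s := hx
      obtain ⟨δ, hδ, hδτ⟩ := Metric.isOpen_iff.1 (isOpen_lt continuous_const hgc) x
        (show τ < g x by rw [hx']; exact hsτ)
      refine ⟨δ, hδ, fun y hy => ?_⟩
      have hz : ∫ r in (x : ℝ)..y, G r = 0 := by
        refine intervalIntegral.integral_zero_ae ?_
        filter_upwards [h0] with r hr hrI
        have hrI' : r ∈ Set.uIcc (x : ℝ) y := Set.uIoc_subset_uIcc hrI
        have hrab : r ∈ Set.Icc a b := Set.ordConnected_Icc.uIcc_subset x.2 y.2 hrI'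
        refine hr hrab (hδτ (a := ⟨r, hrab⟩) ?_)
        rw [Metric.mem_ball, Subtype.dist_eq] at hy ⊢
        refine lt_of_le_of_lt ?_ hy
        rw [Real.dist_eq, Real.dist_eq]
        exact Set.abs_sub_left_of_mem_uIcc hrI'
      have := hg x x.2 y y.2
      rw [hz, sub_eq_zero] at this
      exact this.trans hx'
    have huniv := hclopen.eq_univ ⟨⟨s, hs⟩, rfl⟩
    exact Set.eq_univ_iff_forall.1 huniv ⟨t, ht⟩
  intro s hs t ht
  by_cases h1 : τ < g s
  · rw [key s hs h1 t ht]
  · by_cases h2 : τ < g t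
    · rw [key t ht h2 s hs]
    · rw [max_eq_right (not_lt.1 h1), max_eq_right (not_lt.1 h2)]

theorem hasDerivAt_log_norm_line {p d w : ℂ} {r : ℝ} (h : p + (r : ℂ) * d ≠ w) :
    HasDerivAt (fun s : ℝ => Real.log ‖p + (s : ℂ) * d - w‖)
      (d * (p + (r : ℂ) * d - w)⁻¹).re r := by
  have hne : p + (r : ℂ) * d - w ≠ 0 := sub_ne_zero.2 h
  have h1 : HasDerivAt (fun s : ℝ => p + (s : ℂ) * d - w) d r := by
    have := (((Complex.ofRealCLM.hasDerivAt (x := r)).mul_const d).const_add p).sub_const w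
    simpa using this
  have h2 := h1.norm_sq.log (by positivity)
  have h3 := h2.const_mul (1 / 2)
  refine (h3.congr_deriv ?_).congr_of_eventuallyEq (Eventually.of_forall fun s => ?_)
  · rw [Complex.inner, Complex.inv_def, ← Complex.normSq_eq_norm_sq, ← mul_assoc,
      Complex.re_mul_ofReal]
    ring
  · simp only [Real.log_pow]
    push_cast
    ring

theorem integral_re_cauchyKernel_line {p d w : ℂ} {s t : ℝ}
    (h : ∀ r ∈ Set.uIcc s t, p + (r : ℂ) * d ≠ w) :
    ∫ r in s..t, (d * (p + (r : ℂ) * d - w)⁻¹).re =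
      logKernel (p + (t : ℂ) * d) w - logKernel (p + (s : ℂ) * d) w := by
  rw [intervalIntegral.integral_eq_sub_of_hasDerivAt
    (f := fun s : ℝ => Real.log ‖p + (s : ℂ) * d - w‖)
    (fun r hr => hasDerivAt_log_norm_line (h r hr)), logKernel, logKernel]
  · ring
  · refine ContinuousOn.intervalIntegrable fun r hr => ContinuousAt.continuousWithinAt ?_
    have : p + (r : ℂ) * d - w ≠ 0 := sub_ne_zero.2 (h r hr)
    refine Complex.continuous_re.continuousAt.comp (continuousAt_const.mul (ContinuousAt.inv₀ ?_ this))
    exact ((continuousAt_const.add (Complex.continuous_ofReal.continuousAt.mul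
      continuousAt_const)).sub continuousAt_const)

/-- For each `w` off the segment this is the fundamental theorem of calculus for log‖z - w‖; Fubini
integrates it over `w`. Integrability of the kernel at the single parameter `s₀` propagates along
the segment. -/
theorem logPotential_sub_eq_integral {ν : Measure ℂ} [IsFiniteMeasure ν] {p d : ℂ} {a b s₀ : ℝ}
    (h1 : ∀ᵐ w ∂ν, ∀ r ∈ Set.Icc a b, p + (r : ℂ) * d ≠ w)
    (h2 : Integrable (fun q : ℝ × ℂ => (p + (q.1 : ℂ) * d - q.2)⁻¹)
      ((volume.restrict (Set.Icc a b)).prod ν))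
    (hs₀ : s₀ ∈ Set.Icc a b) (h3 : Integrable (logKernel (p + (s₀ : ℂ) * d)) ν) :
    IntegrableOn (fun r : ℝ => (d * cauchyTransform ν (p + (r : ℂ) * d)).re) (Set.Icc a b) ∧
    ∀ s ∈ Set.Icc a b, ∀ t ∈ Set.Icc a b,
      logPotential ν (p + (t : ℂ) * d) - logPotential ν (p + (s : ℂ) * d) =
        ∫ r in s..t, (d * cauchyTransform ν (p + (r : ℂ) * d)).re := by
  have hre : Integrable (fun q : ℝ × ℂ => (d * (p + (q.1 : ℂ) * d - q.2)⁻¹).re)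
      ((volume.restrict (Set.Icc a b)).prod ν) := (h2.const_mul d).re
  have hLre : ∀ᵐ r : ℝ ∂(volume.restrict (Set.Icc a b)),
      ∫ w, (d * (p + (r : ℂ) * d - w)⁻¹).re ∂ν =
        (d * cauchyTransform ν (p + (r : ℂ) * d)).re := by
    filter_upwards [h2.prod_right_ae] with r hr
    rw [cauchyTransform, ← integral_const_mul]
    exact integral_re (𝕜 := ℂ) (hr.const_mul d)
  have hsub {s t : ℝ} (hs : s ∈ Set.Icc a b) (ht : t ∈ Set.Icc a b) :
      Set.uIoc s t ⊆ Set.Icc a b :=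
    Set.uIoc_subset_uIcc.trans (Set.ordConnected_Icc.uIcc_subset hs ht)
  have hre' {s t : ℝ} (hs : s ∈ Set.Icc a b) (ht : t ∈ Set.Icc a b) :
      Integrable (fun q : ℝ × ℂ => (d * (p + (q.1 : ℂ) * d - q.2)⁻¹).re)
      ((volume.restrict (Set.uIoc s t)).prod ν) :=
    hre.mono_measure (Measure.prod_mono (Measure.restrict_mono (hsub hs ht) le_rfl) le_rfl)
  have hk {s t : ℝ} (hs : s ∈ Set.Icc a b) (ht : t ∈ Set.Icc a b) :
      ∀ᵐ w ∂ν, ∫ r in s..t, (d * (p + (r : ℂ) * d - w)⁻¹).re =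
      logKernel (p + (t : ℂ) * d) w - logKernel (p + (s : ℂ) * d) w := by
    filter_upwards [h1] with w hw
    exact integral_re_cauchyKernel_line fun r hr =>
      hw r (Set.ordConnected_Icc.uIcc_subset hs ht hr)
  have hkint (t : ℝ) (ht : t ∈ Set.Icc a b) : Integrable (logKernel (p + (t : ℂ) * d)) ν := by
    have h4 : Integrable (fun w => ∫ r in s₀..t, (d * (p + (r : ℂ) * d - w)⁻¹).re) ν := by
      have h5 := (hre' hs₀ ht).integral_prod_right
      simp_rw [intervalIntegral.intervalIntegral_eq_integral_uIoc]
      exact h5.smul (if s₀ ≤ t then (1 : ℝ) else -1)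
    refine (h3.add h4).congr ?_
    filter_upwards [hk hs₀ ht] with w hw
    rw [Pi.add_apply, hw]
    ring
  refine ⟨?_, fun s hs t ht => ?_⟩
  · exact hre.integral_prod_left.congr hLre
  · rw [logPotential, logPotential, ← integral_sub (hkint t ht) (hkint s hs),
      ← integral_congr_ae (hk hs ht), ← intervalIntegral_integral_swap (hre' hs ht)]
    refine intervalIntegral.integral_congr_ae ?_
    have := (ae_restrict_iff' measurableSet_Icc).1 hLre
    filter_upwards [this] with r hr hrI
    exact hr (hsub hs ht hrI)

theorem enorm_inv_sub_le (z w : ℂ) : ‖(z - w)⁻¹‖ₑ ≤ 1 + singKernel z w := by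
  rcases (norm_nonneg (z - w)).eq_or_lt with h | h
  · rw [norm_eq_zero.1 h.symm]; simp
  · rcases le_total 1 ‖z - w‖ with h1 | h1
    · refine le_trans ?_ le_self_add
      rw [← ofReal_norm, norm_inv, ENNReal.ofReal_le_one]
      exact inv_le_one_of_one_le₀ h1
    · refine le_trans ?_ le_add_self
      rw [singKernel, ← ENNReal.ofReal_inv_of_pos (by positivity), ← ofReal_norm, norm_inv]
      refine ENNReal.ofReal_le_ofReal (inv_anti₀ (by positivity) ?_)
      exact mul_le_of_le_one_right h.le (Real.sqrt_le_one.2 h1)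

/-- On almost every line in a given direction, the truncated potential is constant if the Cauchy
transform vanishes where the potential exceeds the truncation level. -/
theorem ae_max_logPotential_eq_on_lines {ν : Measure ℂ} [IsFiniteMeasure ν] {d d' : ℂ}
    {ℓ : ℂ → ℝ} (hℓ : Measurable ℓ)
    (hℓd : ∀ r q : ℝ, ℓ ((q : ℂ) * d' + (r : ℂ) * d) = q)
    (he : MeasurePreserving (fun x : ℝ × ℝ => (x.1 : ℂ) * d' + (x.2 : ℂ) * d))
    {a b a' b' τ : ℝ} (hab : a < b)
    (h0 : ∀ᵐ x : ℝ × ℝ, x.1 ∈ Set.Icc a' b' → x.2 ∈ Set.Icc a b →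
      τ < logPotential ν ((x.1 : ℂ) * d' + (x.2 : ℂ) * d) →
        cauchyTransform ν ((x.1 : ℂ) * d' + (x.2 : ℂ) * d) = 0) :
    ∀ᵐ q : ℝ, q ∈ Set.Icc a' b' → ∀ s ∈ Set.Icc a b, ∀ t ∈ Set.Icc a b,
      max (logPotential ν ((q : ℂ) * d' + (s : ℂ) * d)) τ =
        max (logPotential ν ((q : ℂ) * d' + (t : ℂ) * d)) τ := by
  -- Each `w` lies on a single line of the family, so by Fubini almost every line is ν-null, even if
  -- ν has atoms.
  have e1 : ∀ᵐ q : ℝ, ∀ᵐ w ∂ν, ℓ w ≠ q := by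
    rw [Measure.ae_ae_comm]
    · exact Eventually.of_forall fun w => by
        filter_upwards [Measure.ae_ne volume (ℓ w)] with q hq using hq.symm
    · exact (measurableSet_eq_fun (hℓ.comp measurable_snd) measurable_fst).compl
  have e2 : ∀ᵐ q : ℝ, q ∈ Set.Icc a' b' →
      ∫⁻ r in Set.Icc a b, singPotential ν ((q : ℂ) * d' + (r : ℂ) * d) < ⊤ := by
    obtain ⟨C, hC, hsing⟩ := exists_lintegral_singPotential_le
    have hm : Measurable fun x : ℝ × ℝ => singPotential ν ((x.1 : ℂ) * d' + (x.2 : ℂ) * d) :=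
      (measurable_singPotential ν).comp he.measurable
    rw [← ae_restrict_iff' measurableSet_Icc]
    refine ae_lt_top (hm.lintegral_prod_right' (ν := volume.restrict (Set.Icc a b))) (ne_of_lt ?_)
    rw [← lintegral_prod _ hm.aemeasurable, Measure.prod_restrict, ← Measure.volume_eq_prod]
    set S := Set.Icc a' b' ×ˢ Set.Icc a b
    have h1 : (volume.restrict S).map
        (fun x : ℝ × ℝ => (x.1 : ℂ) * d' + (x.2 : ℂ) * d) ≤ volume := by
      refine (Measure.map_mono Measure.restrict_le_self he.measurable).trans ?_
      rw [he.map_eq]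
    rw [← lintegral_map (f := singPotential ν) (measurable_singPotential ν) he.measurable]
    have hfin : volume S < ⊤ := (isCompact_Icc.prod isCompact_Icc).measure_lt_top
    have hf1 : IsFiniteMeasure (volume.restrict S) := ⟨by simpa using hfin⟩
    refine (hsing _ ν inferInstance inferInstance h1).trans_lt ?_
    finiteness
  have e3 : ∀ᵐ q : ℝ, ∀ᵐ r : ℝ, singPotential ν ((q : ℂ) * d' + (r : ℂ) * d) < ⊤ :=
    Measure.ae_ae_of_ae_prod (he.quasiMeasurePreserving.ae (ae_singPotential_lt_top ν))
  have e4 := Measure.ae_ae_of_ae_prod h0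
  filter_upwards [e1, e2, e3, e4] with q h1 h2 h3 h4 hq
  have hline : ∀ᵐ w ∂ν, ∀ r ∈ Set.Icc a b, (q : ℂ) * d' + (r : ℂ) * d ≠ w := by
    filter_upwards [h1] with w hw r _ hrw
    exact hw (by rw [← hrw, hℓd])
  have hint : Integrable (fun x : ℝ × ℂ => ((q : ℂ) * d' + (x.1 : ℂ) * d - x.2)⁻¹)
      ((volume.restrict (Set.Icc a b)).prod ν) := by
    have hmeas : Measurable (fun x : ℝ × ℂ => ((q : ℂ) * d' + (x.1 : ℂ) * d - x.2)⁻¹) := by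
      fun_prop
    refine ⟨hmeas.aestronglyMeasurable, ?_⟩
    rw [HasFiniteIntegral, lintegral_prod _ hmeas.enorm.aemeasurable]
    have h5 : ∀ r : ℝ, ∫⁻ w, ‖((q : ℂ) * d' + (r : ℂ) * d - w)⁻¹‖ₑ ∂ν ≤
        ν Set.univ + singPotential ν ((q : ℂ) * d' + (r : ℂ) * d) := fun r => by
      refine (lintegral_mono fun w => enorm_inv_sub_le _ w).trans ?_
      rw [lintegral_add_left measurable_const, lintegral_one, singPotential]
    refine (lintegral_mono fun r => h5 r).trans_lt ?_
    rw [lintegral_add_left measurable_const, lintegral_const]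
    have := h2 hq
    have hfin : volume (Set.Icc a b) < ⊤ := isCompact_Icc.measure_lt_top
    rw [Measure.restrict_apply_univ]
    finiteness
  obtain ⟨s₀, hs₀, hs₀'⟩ : ∃ s₀ ∈ Set.Icc a b,
      singPotential ν ((q : ℂ) * d' + (s₀ : ℂ) * d) < ⊤ := by
    by_contra! hcon
    have h6 : volume (Set.Icc a b) = 0 := by
      refine measure_mono_null (fun r hr => ?_) h3
      exact not_lt.2 (hcon r hr)
    rw [Real.volume_Icc, ENNReal.ofReal_eq_zero] at h6
    linarith
  obtain ⟨hG, hg⟩ := logPotential_sub_eq_integral hline hint hs₀ (integrable_logKernel hs₀')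
  refine max_eq_max_of_integral_eq_sub
    (g := fun r : ℝ => logPotential ν ((q : ℂ) * d' + (r : ℂ) * d)) hG hg ?_
  filter_upwards [h4] with r hr hrI hrτ
  simp [hr hq hrI hrτ]

/-- If the Cauchy transform vanishes almost everywhere in a square where the potential exceeds
`τ`, then the truncation of the potential at `τ` is constant almost everywhere in the square. -/
theorem exists_ae_max_logPotential_eq {ν : Measure ℂ} [IsFiniteMeasure ν] {a b a' b' τ : ℝ}
    (hab : a < b) (hab' : a' < b')
    (h0 : ∀ᵐ z : ℂ, z ∈ Set.Icc a b ×ℂ Set.Icc a' b' → τ < logPotential ν z →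
      cauchyTransform ν z = 0) :
    ∃ β, ∀ᵐ z : ℂ, z ∈ Set.Icc a b ×ℂ Set.Icc a' b' → max (logPotential ν z) τ = β := by
  have m1 : MeasurePreserving (fun x : ℝ × ℝ => (x.1 : ℂ) * 1 + (x.2 : ℂ) * Complex.I) := by
    have := Complex.volume_preserving_equiv_real_prod.symm
    convert this using 2 with x
    apply Complex.ext <;> simp
  have m2 : MeasurePreserving (fun x : ℝ × ℝ => (x.1 : ℂ) * Complex.I + (x.2 : ℂ) * 1) := by
    have h : MeasurePreserving (fun x : ℝ × ℝ => x.swap) volume volume :=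
      Measure.measurePreserving_swap (μ := volume) (ν := volume)
    have e : (fun x : ℝ × ℝ => (x.1 : ℂ) * Complex.I + (x.2 : ℂ) * 1) =
        (fun x : ℝ × ℝ => (x.1 : ℂ) * 1 + (x.2 : ℂ) * Complex.I) ∘ fun x => x.swap :=
      funext fun x => add_comm _ _
    rw [e]
    exact m1.comp h
  have A := ae_max_logPotential_eq_on_lines (ν := ν) (d := Complex.I) (d' := 1) (τ := τ)
    (ℓ := Complex.re) (a := a') (b := b') (a' := a) (b' := b)
    Complex.measurable_re (fun r q => by simp) m1 hab' (by
      filter_upwards [m1.quasiMeasurePreserving.ae h0] with x hx h1 h2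
      exact hx (by simpa [Complex.mem_reProdIm] using ⟨h1, h2⟩))
  have B := ae_max_logPotential_eq_on_lines (ν := ν) (d := 1) (d' := Complex.I) (τ := τ)
    (ℓ := Complex.im) (a := a) (b := b) (a' := a') (b' := b')
    Complex.measurable_im (fun r q => by simp) m2 hab (by
      filter_upwards [m2.quasiMeasurePreserving.ae h0] with x hx h1 h2
      exact hx (by simpa [Complex.mem_reProdIm] using ⟨h2, h1⟩))
  -- One good vertical line suffices: almost every point of the square is joined to it by a good
  -- horizontal line.
  obtain ⟨x₀, hx₀, hx₀'⟩ : ∃ x₀ ∈ Set.Icc a b, ∀ s ∈ Set.Icc a' b', ∀ t ∈ Set.Icc a' b',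
      max (logPotential ν ((x₀ : ℂ) * 1 + (s : ℂ) * Complex.I)) τ =
        max (logPotential ν ((x₀ : ℂ) * 1 + (t : ℂ) * Complex.I)) τ := by
    by_contra! hcon
    have h6 : volume (Set.Icc a b) = 0 := by
      refine measure_mono_null (fun r hr => ?_) A
      obtain ⟨s, hs, t, ht, hst⟩ := hcon r hr
      exact fun hr' => hst (hr' hr s hs t ht)
    rw [Real.volume_Icc, ENNReal.ofReal_eq_zero] at h6
    linarith
  refine ⟨max (logPotential ν ((x₀ : ℂ) * 1 + (a' : ℂ) * Complex.I)) τ, ?_⟩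
  have him : Measure.QuasiMeasurePreserving Complex.im := by
    have := (Measure.quasiMeasurePreserving_snd (μ := (volume : Measure ℝ))
      (ν := (volume : Measure ℝ))).comp
      Complex.volume_preserving_equiv_real_prod.quasiMeasurePreserving
    exact this
  filter_upwards [him.ae B] with z hz hzQ
  obtain ⟨hzr, hzi⟩ := Complex.mem_reProdIm.1 hzQ
  rw [hx₀' a' (Set.left_mem_Icc.2 hab'.le) z.im hzi]
  have h1 := hz hzi z.re hzr x₀ hx₀
  have h2 : (z.im : ℂ) * Complex.I + (z.re : ℂ) * 1 = z := by apply Complex.ext <;> simp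
  rw [h2] at h1
  rw [h1, add_comm]

/-! ### The Cauchy transform off the support. -/

theorem ae_le_norm_sub_of_ball_subset {ν : Measure ℂ} {x : ℂ} {r : ℝ}
    (h : Metric.ball x r ⊆ ν.supportᶜ) {z : ℂ} : ∀ᵐ w ∂ν, r - ‖z - x‖ ≤ ‖z - w‖ := by
  filter_upwards [Measure.support_mem_ae (μ := ν)] with w hw
  by_contra! hlt
  refine h (a := w) ?_ hw
  rw [Metric.mem_ball, dist_eq_norm]
  have := norm_sub_le_norm_sub_add_norm_sub w z x
  rw [norm_sub_rev w z] at this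
  linarith

theorem singPotential_lt_top_of_notMem_support {ν : Measure ℂ} [IsFiniteMeasure ν] {z : ℂ}
    (hz : z ∉ ν.support) : singPotential ν z < ⊤ := by
  obtain ⟨r, hr, hrz⟩ := Metric.isOpen_iff.1 Measure.isOpen_compl_support z hz
  have h1 : singPotential ν z ≤ ∫⁻ _, (ENNReal.ofReal (r * √r))⁻¹ ∂ν := by
    refine lintegral_mono_ae ?_
    filter_upwards [ae_le_norm_sub_of_ball_subset hrz (z := z)] with w hw
    rw [sub_self, norm_zero, sub_zero] at hw
    refine ENNReal.inv_le_inv.2 (ENNReal.ofReal_le_ofReal ?_)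
    exact mul_le_mul hw (Real.sqrt_le_sqrt hw) (Real.sqrt_nonneg _) (norm_nonneg _)
  refine h1.trans_lt ?_
  rw [lintegral_const]
  refine ENNReal.mul_lt_top ?_ (measure_lt_top _ _)
  rw [ENNReal.inv_lt_top, ENNReal.ofReal_pos]
  positivity

/-- The Cauchy transform is holomorphic off the support of the measure. -/
theorem differentiableOn_cauchyTransform (ν : Measure ℂ) [IsFiniteMeasure ν] :
    DifferentiableOn ℂ (cauchyTransform ν) ν.supportᶜ := by
  intro x hx
  obtain ⟨r, hr, hrx⟩ := Metric.isOpen_iff.1 Measure.isOpen_compl_support x hx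
  have h := hasDerivAt_integral_of_dominated_loc_of_deriv_le (μ := ν) (x₀ := x)
    (F := fun z w : ℂ => (z - w)⁻¹) (F' := fun z w => -1 / (z - w) ^ 2)
    (s := Metric.ball x (r / 2)) (bound := fun _ => ((r / 2) ^ 2)⁻¹)
    (Metric.ball_mem_nhds x (by positivity)) ?_ ?_ ?_ ?_ (integrable_const _) ?_
  · exact h.2.differentiableAt.differentiableWithinAt
  · exact Eventually.of_forall fun z =>
      (stronglyMeasurable_cauchyKernel.comp_measurable
        measurable_prodMk_left).aestronglyMeasurable
  · exact integrable_cauchyKernel (singPotential_lt_top_of_notMem_support hx)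
  · exact Measurable.aestronglyMeasurable (by fun_prop)
  · filter_upwards [ae_all_of_ball hrx] with w hw z hz
    have h1 := hw z hz
    rw [norm_div, norm_neg, norm_one, norm_pow, one_div]
    exact inv_anti₀ (by positivity) (pow_le_pow_left₀ (by positivity) h1 2)
  · filter_upwards [ae_all_of_ball hrx] with w hw z hz
    have h1 := hw z hz
    have h2 : z - w ≠ 0 := norm_pos_iff.1 (lt_of_lt_of_le (by positivity) h1)
    exact ((hasDerivAt_id z).sub_const w).fun_inv h2
where
  ae_all_of_ball {ν : Measure ℂ} {x : ℂ} {r : ℝ} (h : Metric.ball x r ⊆ ν.supportᶜ) :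
      ∀ᵐ w ∂ν, ∀ z ∈ Metric.ball x (r / 2), r / 2 ≤ ‖z - w‖ := by
    filter_upwards [Measure.support_mem_ae (μ := ν)] with w hw z hz
    by_contra! hlt
    refine h (a := w) ?_ hw
    rw [Metric.mem_ball] at hz ⊢
    rw [← dist_eq_norm, dist_comm] at hlt
    have := dist_triangle w z x
    linarith

/-- On the radius from `x` to `z` the kernels are bounded, and the potential is the integral of the
real part of (z - x) times the Cauchy transform. -/
theorem logPotential_eq_of_cauchyTransform_eq_zero {ν : Measure ℂ} [IsFiniteMeasure ν] {x z : ℂ}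
    {r : ℝ} (hball : Metric.ball x r ⊆ ν.supportᶜ)
    (h0 : ∀ y ∈ Metric.ball x r, cauchyTransform ν y = 0) (hz : z ∈ Metric.ball x r) :
    logPotential ν z = logPotential ν x := by
  have hr : 0 < r := Metric.pos_of_mem_ball hz
  have hδ : 0 < r - ‖z - x‖ := by
    rw [Metric.mem_ball, dist_eq_norm] at hz; linarith
  have hmem : ∀ s ∈ Set.Icc (0 : ℝ) 1, ‖x + (s : ℂ) * (z - x) - x‖ ≤ ‖z - x‖ := fun s hs => by
    rw [add_sub_cancel_left, norm_mul, Complex.norm_real, Real.norm_of_nonneg hs.1]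
    exact mul_le_of_le_one_left (norm_nonneg _) hs.2
  have hball' : ∀ s ∈ Set.Icc (0 : ℝ) 1, x + (s : ℂ) * (z - x) ∈ Metric.ball x r := fun s hs => by
    rw [Metric.mem_ball, dist_eq_norm]
    linarith [hmem s hs]
  have hle : ∀ᵐ w ∂ν, ∀ s ∈ Set.Icc (0 : ℝ) 1, r - ‖z - x‖ ≤ ‖x + (s : ℂ) * (z - x) - w‖ := by
    filter_upwards [Measure.support_mem_ae (μ := ν)] with w hw s hs
    by_contra! hlt
    refine hball (a := w) ?_ hw
    rw [Metric.mem_ball, dist_eq_norm]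
    have h1 := norm_sub_le_norm_sub_add_norm_sub w (x + (s : ℂ) * (z - x)) x
    rw [norm_sub_rev w (x + (s : ℂ) * (z - x))] at h1
    linarith [hmem s hs]
  have hx : x ∈ Metric.ball x r := Metric.mem_ball_self hr
  obtain ⟨-, h⟩ := logPotential_sub_eq_integral (ν := ν) (p := x) (d := z - x) (a := 0) (b := 1)
    (s₀ := 0) (by
      filter_upwards [hle] with w hw s hs hsw
      have := hw s hs
      rw [hsw, sub_self, norm_zero] at this
      linarith) (by
      have hm : Measurable (fun q : ℝ × ℂ => (x + (q.1 : ℂ) * (z - x) - q.2)⁻¹) := by fun_prop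
      refine Integrable.of_bound hm.aestronglyMeasurable (r - ‖z - x‖)⁻¹ ?_
      have hms : MeasurableSet {q : ℝ × ℂ | ‖(x + (q.1 : ℂ) * (z - x) - q.2)⁻¹‖ ≤
          (r - ‖z - x‖)⁻¹} := measurableSet_le hm.norm measurable_const
      rw [Measure.ae_prod_iff_ae_ae hms]
      filter_upwards [ae_restrict_mem measurableSet_Icc] with s hs
      filter_upwards [hle] with w hw
      rw [norm_inv]
      exact inv_anti₀ hδ (hw s hs)) (by simp)
      (integrable_logKernel (by simpa using singPotential_lt_top_of_notMem_support (hball hx)))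
  have h1 := h 0 (by simp) 1 (by simp)
  rw [intervalIntegral.integral_congr (g := fun _ => 0)] at h1
  · simpa [sub_eq_zero] using h1
  · intro s hs
    rw [Set.uIcc_of_le zero_le_one] at hs
    simp [h0 _ (hball' s hs)]

theorem logPotential_eqOn_of_cauchyTransform_eq_zero {ν : Measure ℂ} [IsFiniteMeasure ν]
    {W : Set ℂ} (hW : IsOpen W) (hWc : IsPreconnected W) (hWs : W ⊆ ν.supportᶜ)
    (h0 : ∀ y ∈ W, cauchyTransform ν y = 0) :
    ∀ x ∈ W, ∀ z ∈ W, logPotential ν z = logPotential ν x := by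
  have hpc : PreconnectedSpace W := isPreconnected_iff_preconnectedSpace.1 hWc
  have hloc : IsLocallyConstant fun z : W => logPotential ν z := by
    rw [IsLocallyConstant.iff_eventually_eq]
    intro x
    obtain ⟨r, hr, hrW⟩ := Metric.isOpen_iff.1 hW x x.2
    filter_upwards [Metric.ball_mem_nhds x hr] with y hy
    exact logPotential_eq_of_cauchyTransform_eq_zero (hrW.trans hWs) (fun y hy => h0 y (hrW hy)) hy
  exact fun x hx z hz => hloc.apply_eq_of_preconnectedSpace ⟨z, hz⟩ ⟨x, hx⟩

/-! ### Growth of potentials on large circles. -/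

theorem exists_lintegral_inv_sqrt_le : ∃ C : ℝ≥0∞, C < ⊤ ∧ ∀ σ : ℝ,
    ∫⁻ s in Set.Icc (1 : ℝ) 2, (ENNReal.ofReal (√|s - σ|))⁻¹ ≤ C := by
  have hint : IntegrableOn (fun z : ℝ => ‖z‖ ^ (-(1 / 2 : ℝ))) (Metric.ball 0 1) volume := by
    refine integrableOn_ball_of_norm_le_rpow (C := 1) (α := 1 / 2) ?_ ?_ ?_ ?_
    · simp
    · rw [Module.finrank_self]; norm_num
    · refine Eventually.of_forall fun z => ?_
      rw [one_mul, Real.norm_of_nonneg (by positivity)]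
    · exact (measurable_norm.pow_const _).aestronglyMeasurable
  refine ⟨(∫⁻ s in Metric.ball (0 : ℝ) 1, (ENNReal.ofReal (√|s|))⁻¹) + 1,
    ENNReal.add_lt_top.2 ⟨?_, ENNReal.one_lt_top⟩, fun σ => ?_⟩
  · refine lt_of_le_of_lt (lintegral_mono_ae ?_) hint.2
    refine Eventually.filter_mono (ae_mono Measure.restrict_le_self) ?_
    filter_upwards [Measure.ae_ne volume (0 : ℝ)] with z hz
    have hz' : 0 < |z| := abs_pos.2 hz
    rw [← ENNReal.ofReal_inv_of_pos (by positivity), ← ofReal_norm,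
      Real.norm_of_nonneg (by positivity), Real.norm_eq_abs, Real.rpow_neg hz'.le,
      ← Real.sqrt_eq_rpow]
  · have h1 : ∀ s : ℝ, (ENNReal.ofReal (√|s - σ|))⁻¹ ≤
        (Metric.ball σ 1).indicator (fun s => (ENNReal.ofReal (√|s - σ|))⁻¹) s + 1 := by
      intro z
      by_cases hz : z ∈ Metric.ball σ 1
      · rw [Set.indicator_of_mem hz]; exact le_self_add
      · rw [Set.indicator_of_notMem hz, zero_add, ENNReal.inv_le_one, ENNReal.one_le_ofReal]
        have h2 : 1 ≤ |z - σ| := by simpa [Real.dist_eq] using hz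
        exact Real.one_le_sqrt.2 h2
    refine (lintegral_mono h1).trans ?_
    rw [lintegral_add_right _ measurable_const, setLIntegral_one, Real.volume_Icc]
    refine add_le_add ?_ (by norm_num)
    refine (lintegral_mono' Measure.restrict_le_self le_rfl).trans ?_
    rw [← lintegral_indicator Metric.isOpen_ball.measurableSet,
      ← lintegral_add_right_eq_self _ σ]
    refine lintegral_mono fun z => ?_
    by_cases hz : z ∈ Metric.ball (0 : ℝ) 1
    · rw [Set.indicator_of_mem hz, Set.indicator_of_mem (by simpa [Real.dist_eq] using hz)]
      simp
    · rw [Set.indicator_of_notMem hz, Set.indicator_of_notMem (by simpa [Real.dist_eq] using hz)]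

theorem log_ge_neg_two_inv_sqrt {x : ℝ} (hx : 0 < x) : -(2 * (√x)⁻¹) ≤ Real.log x := by
  have hs : 0 < √x := Real.sqrt_pos.2 hx
  have h1 := Real.log_le_sub_one_of_pos (inv_pos.2 hs)
  rw [Real.log_inv, Real.log_sqrt hx.le] at h1
  linarith

/-- Only ‖z‖ is known, so ‖z - w‖ is bounded below by |‖z‖ - ‖w‖|, which leaves a singularity in the
radius alone, integrable over s ∈ [1, 2]. The first bound is uniform in `w`; the second grows like
log R for bounded `w`. The constant 5 comes from separating ‖w‖ ≤ 4R from ‖w‖ ≥ 4R. -/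
theorem logKernel_lower_bound {R s : ℝ} (hR : 1 ≤ R) (hs2 : s ≤ 2) {z w : ℂ}
    (hz : ‖z‖ = R * s) (hsw : s ≠ ‖w‖ / R) :
    -Real.log 5 - 2 * (√|s - ‖w‖ / R|)⁻¹ ≤ logKernel z w ∧
    Real.log R - 1 / 2 * Real.log (1 + ‖w‖ ^ 2) - 2 * (√|s - ‖w‖ / R|)⁻¹ ≤ logKernel z w := by
  have hR0 : 0 < R := by linarith
  have habs : 0 < |s - ‖w‖ / R| := abs_pos.2 (sub_ne_zero.2 hsw)
  have h1 : R * |s - ‖w‖ / R| ≤ ‖z - w‖ := by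
    have h2 := abs_norm_sub_norm_le z w
    rw [hz] at h2
    rwa [← abs_of_pos hR0, ← abs_mul, abs_of_pos hR0, mul_sub, mul_div_cancel₀ _ hR0.ne']
  have h3 : Real.log R + Real.log |s - ‖w‖ / R| ≤ Real.log ‖z - w‖ := by
    rw [← Real.log_mul hR0.ne' habs.ne']
    exact Real.log_le_log (by positivity) h1
  have h4 := log_ge_neg_two_inv_sqrt habs
  have h5 : Real.log R - 1 / 2 * Real.log (1 + ‖w‖ ^ 2) - 2 * (√|s - ‖w‖ / R|)⁻¹ ≤
      logKernel z w := by unfold logKernel; linarith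
  refine ⟨?_, h5⟩
  have hpos : 0 ≤ 2 * (√|s - ‖w‖ / R|)⁻¹ := by positivity
  have hw := norm_nonneg w
  rcases le_total ‖w‖ (4 * R) with h | h
  · have h6 : Real.log (1 + ‖w‖ ^ 2) ≤ Real.log ((5 * R) ^ 2) :=
      Real.log_le_log (by positivity) (by nlinarith)
    rw [Real.log_pow, Real.log_mul (by norm_num) hR0.ne'] at h6
    push_cast at h6
    linarith
  · have h6 : ‖w‖ / 2 ≤ ‖z - w‖ := by
      have h7 := norm_sub_norm_le w z
      rw [norm_sub_rev w z, hz] at h7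
      nlinarith
    have hw0 : 0 < ‖w‖ := by linarith
    have h8 : Real.log (1 + ‖w‖ ^ 2) ≤ Real.log ((5 * (‖w‖ / 2)) ^ 2) :=
      Real.log_le_log (by positivity) (by nlinarith)
    rw [Real.log_pow, Real.log_mul (by norm_num) (by positivity)] at h8
    have h9 := Real.log_le_log (by positivity) h6
    push_cast at h8
    unfold logKernel
    linarith

/-- A nonzero finite measure has unbounded potential on any set meeting all large circles. -/
theorem eq_zero_of_logPotential_le_on_circles {ν : Measure ℂ} [IsFiniteMeasure ν] {c r₀ : ℝ}
    (h : ∀ r, r₀ ≤ r → ∃ z : ℂ, ‖z‖ = r ∧ Integrable (logKernel z) ν ∧ logPotential ν z ≤ c) :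
    ν = 0 := by
  by_contra hν
  obtain ⟨A, hA⟩ : ∃ A : ℕ, 0 < ν.real (Metric.closedBall 0 A) := by
    by_contra! hcon
    refine hν (Measure.measure_univ_eq_zero.1 ?_)
    rw [← Metric.iUnion_closedBall_nat (0 : ℂ)]
    refine measure_iUnion_null fun n => ?_
    exact (measureReal_eq_zero_iff).1 (le_antisymm (hcon n) measureReal_nonneg)
  obtain ⟨C, hC, hCs⟩ := exists_lintegral_inv_sqrt_le
  set a := ν.real (Metric.closedBall 0 A) with ha
  set m := ν.real Set.univ with hm
  set D := (C * ν Set.univ).toReal with hD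
  have hCt : C * ν Set.univ < ⊤ := by finiteness
  have key : ∀ R : ℝ, 1 ≤ R → r₀ ≤ R →
      a * (Real.log R - 1 / 2 * Real.log (1 + (A : ℝ) ^ 2)) ≤ c + m * Real.log 5 + 2 * D := by
    intro R hR hRr
    have hR0 : 0 < R := by linarith
    have hHm : Measurable fun x : ℝ × ℂ => (ENNReal.ofReal (√|x.1 - ‖x.2‖ / R|))⁻¹ := by fun_prop
    have hprob : IsProbabilityMeasure (volume.restrict (Set.Icc (1 : ℝ) 2)) :=
      ⟨by rw [Measure.restrict_apply_univ, Real.volume_Icc]; norm_num⟩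
    -- The interval [1, 2] has length one, so averaging over it gives a radius factor `s` whose
    -- total singular contribution is bounded independently of `R`.
    obtain ⟨s, hs, hsle⟩ := exists_notMem_null_le_lintegral
      (μ := volume.restrict (Set.Icc (1 : ℝ) 2))
      (f := fun s => ∫⁻ w, (ENNReal.ofReal (√|s - ‖w‖ / R|))⁻¹ ∂ν) (N := (Set.Icc 1 2)ᶜ)
      (hHm.lintegral_prod_right' (ν := ν)).aemeasurable
      (by rw [Measure.restrict_apply measurableSet_Icc.compl, Set.compl_inter_self, measure_empty])
    rw [Set.mem_compl_iff, not_not] at hs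
    rw [lintegral_lintegral_swap (f := fun s w => (ENNReal.ofReal (√|s - ‖w‖ / R|))⁻¹)
      hHm.aemeasurable] at hsle
    replace hsle : ∫⁻ w, (ENNReal.ofReal (√|s - ‖w‖ / R|))⁻¹ ∂ν ≤ C * ν Set.univ := by
      refine hsle.trans ((lintegral_mono fun w => hCs (‖w‖ / R)).trans ?_)
      rw [lintegral_const]
    have hHw : Measurable fun w : ℂ => (ENNReal.ofReal (√|s - ‖w‖ / R|))⁻¹ := by fun_prop
    have hne : ∀ᵐ w ∂ν, s ≠ ‖w‖ / R := by
      filter_upwards [ae_lt_top hHw (hsle.trans_lt hCt).ne] with w hw hsw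
      simp [← hsw] at hw
    have hHe : (fun w : ℂ => ENNReal.ofReal (√|s - ‖w‖ / R|)⁻¹) =ᵐ[ν]
        fun w => (ENNReal.ofReal (√|s - ‖w‖ / R|))⁻¹ := by
      filter_upwards [hne] with w hw
      have : 0 < |s - ‖w‖ / R| := abs_pos.2 (sub_ne_zero.2 hw)
      rw [ENNReal.ofReal_inv_of_pos (by positivity)]
    have hHr : Measurable fun w : ℂ => (√|s - ‖w‖ / R|)⁻¹ := by fun_prop
    have hHi : Integrable (fun w : ℂ => (√|s - ‖w‖ / R|)⁻¹) ν := by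
      refine ⟨hHr.aestronglyMeasurable, ?_⟩
      rw [hasFiniteIntegral_iff_ofReal (Eventually.of_forall fun w => by positivity),
        lintegral_congr_ae hHe]
      exact hsle.trans_lt hCt
    have hHint : ∫ w, (√|s - ‖w‖ / R|)⁻¹ ∂ν ≤ D := by
      rw [integral_eq_lintegral_of_nonneg_ae (Eventually.of_forall fun w => by positivity)
        hHr.aestronglyMeasurable, lintegral_congr_ae hHe]
      exact ENNReal.toReal_mono hCt.ne hsle
    obtain ⟨z, hz, hzi, hzc⟩ := h (R * s) (hRr.trans (le_mul_of_one_le_right hR0.le hs.1))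
    have i1 : Integrable (fun w : ℂ => (Metric.closedBall (0 : ℂ) A).indicator
        (fun _ => Real.log R - 1 / 2 * Real.log (1 + (A : ℝ) ^ 2)) w) ν :=
      (integrable_const _).indicator Metric.isClosed_closedBall.measurableSet
    have i2 : Integrable (fun w : ℂ => (Metric.closedBall (0 : ℂ) A).indicator
        (fun _ => Real.log R - 1 / 2 * Real.log (1 + (A : ℝ) ^ 2)) w - Real.log 5) ν :=
      i1.sub (integrable_const _)
    have hlow : ∫ w, ((Metric.closedBall (0 : ℂ) A).indicator
        (fun _ => Real.log R - 1 / 2 * Real.log (1 + (A : ℝ) ^ 2)) w - Real.log 5 -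
        2 * (√|s - ‖w‖ / R|)⁻¹) ∂ν ≤ logPotential ν z := by
      refine integral_mono_ae ?_ hzi ?_
      · exact i2.sub (hHi.const_mul 2)
      · filter_upwards [hne] with w hw
        obtain ⟨l1, l2⟩ := logKernel_lower_bound hR hs.2 hz hw
        by_cases hwA : w ∈ Metric.closedBall (0 : ℂ) A
        · rw [Set.indicator_of_mem hwA]
          have h5 : 0 ≤ Real.log 5 := Real.log_nonneg (by norm_num)
          have h6 : Real.log (1 + ‖w‖ ^ 2) ≤ Real.log (1 + (A : ℝ) ^ 2) := by
            refine Real.log_le_log (by positivity) ?_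
            have : ‖w‖ ≤ A := by simpa using hwA
            gcongr
          linarith
        · rw [Set.indicator_of_notMem hwA]
          linarith
    rw [integral_sub i2 (hHi.const_mul 2), integral_sub i1 (integrable_const _),
      integral_indicator_const _ Metric.isClosed_closedBall.measurableSet, integral_const,
      integral_const_mul, smul_eq_mul, smul_eq_mul] at hlow
    linarith
  -- The mass `a` of a fixed ball is positive, so it contributes a log R, while every other term
  -- stays bounded.
  have hlim : Tendsto (fun R : ℝ => a * (Real.log R - 1 / 2 * Real.log (1 + (A : ℝ) ^ 2))) atTop
      atTop :=
    (tendsto_atTop_add_const_right _ _ Real.tendsto_log_atTop).const_mul_atTop hA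
  obtain ⟨R, hR1, hR2, hR3⟩ := ((eventually_ge_atTop 1).and ((eventually_ge_atTop r₀).and
    (hlim.eventually_gt_atTop (c + m * Real.log 5 + 2 * D)))).exists
  exact absurd (key R hR1 hR2) (not_le.2 hR3)

/-- If the complement of the support has no bounded component, then the Cauchy transform of a
nonzero finite measure is nonzero almost everywhere off the support. -/
theorem ae_cauchyTransform_ne_zero {ν : Measure ℂ} [IsFiniteMeasure ν] (hν : ν ≠ 0)
    (hcompl : NoBoundedComponent ν.supportᶜ) :
    ∀ᵐ z, z ∉ ν.support → cauchyTransform ν z ≠ 0 := by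
  have hΩ : IsOpen ν.supportᶜ := Measure.isOpen_compl_support
  have hnull : volume {z | z ∈ ν.supportᶜ ∧ cauchyTransform ν z = 0} = 0 := by
    refine measure_null_of_locally_null _ fun x hx => ?_
    set W := connectedComponentIn ν.supportᶜ x with hWdef
    have hxW : x ∈ W := mem_connectedComponentIn hx.1
    have hW : IsOpen W := hΩ.connectedComponentIn
    have hWs : W ⊆ ν.supportᶜ := connectedComponentIn_subset _ _
    have hWc : IsPreconnected W := isPreconnected_connectedComponentIn
    refine ⟨{z | z ∈ W ∧ cauchyTransform ν z = 0}, ?_, ?_⟩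
    · rw [mem_nhdsWithin]
      exact ⟨W, hW, hxW, fun z hz => ⟨hz.1, hz.2.2⟩⟩
    have han : AnalyticOnNhd ℂ (cauchyTransform ν) W :=
      ((differentiableOn_cauchyTransform ν).mono hWs).analyticOnNhd hW
    -- Either the transform vanishes on the whole component, where the potential is then constant
    -- although this unbounded connected set meets every large circle, or its zeros there are
    -- discrete and hence null.
    rcases han.eqOn_zero_or_eventually_ne_zero_of_preconnected hWc with h0 | h0
    · exfalso
      have hconst := logPotential_eqOn_of_cauchyTransform_eq_zero hW hWc hWs h0
      refine hν (eq_zero_of_logPotential_le_on_circles (c := logPotential ν x) (r₀ := ‖x‖)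
        fun r hr => ?_)
      obtain ⟨y, hy, hyr⟩ : ∃ y ∈ W, r ≤ ‖y‖ := by
        by_contra! hcon
        exact hcompl x hx.1 (isBounded_iff_forall_norm_le.2 ⟨r, fun y hy => (hcon y hy).le⟩)
      obtain ⟨z, hz, hzr⟩ := hWc.intermediate_value hxW hy continuous_norm.continuousOn ⟨hr, hyr⟩
      exact ⟨z, hzr, integrable_logKernel (singPotential_lt_top_of_notMem_support (hWs hz)),
        (hconst x hxW z hz).le⟩
    · have h1 := ae_restrict_le_codiscreteWithin (μ := (volume : Measure ℂ)) hW.measurableSet h0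
      have h2 := (ae_restrict_iff' hW.measurableSet).1 h1
      refine measure_mono_null (fun z hz => ?_) h2
      exact fun hcon => hcon hz.1 hz.2
  filter_upwards [measure_eq_zero_iff_ae_notMem.1 hnull] with z hz hzs h0
  exact hz ⟨hzs, h0⟩

/-! ### Empirical measures of polynomials and of their derivatives. -/

theorem integral_sum_dirac {E : Type*} [NormedAddCommGroup E] [NormedSpace ℝ E]
    [CompleteSpace E] (s : Multiset ℂ) (f : ℂ → E) :
    Integrable f (s.map fun z => Measure.dirac z).sum ∧
      ∫ z, f z ∂(s.map fun z => Measure.dirac z).sum = (s.map f).sum := by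
  induction s using Multiset.induction with
  | empty => simp
  | cons a s ih =>
    have ha : Integrable f (Measure.dirac a) := integrable_dirac (by simp)
    simp only [Multiset.map_cons, Multiset.sum_cons]
    refine ⟨ha.add_measure ih.1, ?_⟩
    rw [integral_add_measure ha ih.1, ih.2, integral_dirac]

theorem integral_empiricalMeasure {E : Type*} [NormedAddCommGroup E] [NormedSpace ℝ E]
    [CompleteSpace E] (p : ℂ[X]) (f : ℂ → E) :
    ∫ z, f z ∂(empiricalMeasure p) = (p.natDegree : ℝ)⁻¹ • (p.roots.map f).sum := by
  rw [empiricalMeasure, integral_smul_measure, (integral_sum_dirac _ _).2]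
  simp

theorem empiricalMeasure_univ {p : ℂ[X]} (hp : p.natDegree ≠ 0) :
    empiricalMeasure p Set.univ = 1 := by
  have h (s : Multiset ℂ) : (s.map fun z => Measure.dirac z).sum Set.univ = (s.card : ℝ≥0∞) := by
    induction s using Multiset.induction with
    | empty => simp
    | cons a s ih => simp [ih, add_comm]
  rw [empiricalMeasure, Measure.smul_apply, h, smul_eq_mul,
    ← (IsAlgClosed.splits p).natDegree_eq_card_roots]
  exact ENNReal.inv_mul_cancel (by exact_mod_cast hp) (ENNReal.natCast_ne_top _)

/-- For a constant polynomial the factor is `⊤` but there are no roots, and the measure is zero;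
hence no index has to be excluded. -/
theorem empiricalMeasure_univ_le_one (p : ℂ[X]) : empiricalMeasure p Set.univ ≤ 1 := by
  by_cases hp : p.natDegree = 0
  · have : p.roots = 0 := by
      rw [← Multiset.card_eq_zero, ← (IsAlgClosed.splits p).natDegree_eq_card_roots, hp]
    simp [empiricalMeasure, this]
  · exact (empiricalMeasure_univ hp).le

/-- The constant `A` collects the leading coefficient and the normalising terms of the kernel; it
depends on `p` but not on `z`. -/
theorem exists_logPotential_empiricalMeasure {p : ℂ[X]} (hp : p.natDegree ≠ 0) :
    ∃ A : ℝ, ∀ z, p.eval z ≠ 0 →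
      p.natDegree * logPotential (empiricalMeasure p) z = Real.log ‖p.eval z‖ - A := by
  have hp0 : p ≠ 0 := by rintro rfl; simp at hp
  refine ⟨Real.log ‖p.leadingCoeff‖ +
    (p.roots.map fun w => 1 / 2 * Real.log (1 + ‖w‖ ^ 2)).sum, fun z hz => ?_⟩
  have hd : (p.natDegree : ℝ) ≠ 0 := by exact_mod_cast hp
  rw [logPotential, integral_empiricalMeasure, smul_eq_mul, mul_inv_cancel_left₀ hd]
  have hlog (s : Multiset ℂ) (hs : z ∉ s) :
      (s.map fun w => Real.log ‖z - w‖).sum = Real.log ‖(s.map fun w => z - w).prod‖ ∧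
        (s.map fun w => z - w).prod ≠ 0 := by
    induction s using Multiset.induction with
    | empty => simp
    | cons a s ih =>
      rw [Multiset.mem_cons, not_or] at hs
      have h1 : z - a ≠ 0 := sub_ne_zero.2 hs.1
      obtain ⟨h2, h3⟩ := ih hs.2
      simp only [Multiset.map_cons, Multiset.sum_cons, Multiset.prod_cons]
      refine ⟨?_, mul_ne_zero h1 h3⟩
      rw [h2, norm_mul, Real.log_mul (norm_ne_zero_iff.2 h1) (norm_ne_zero_iff.2 h3)]
  obtain ⟨h2, h3⟩ := hlog p.roots fun h => hz (isRoot_of_mem_roots h)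
  have h1 : p.eval z = p.leadingCoeff * (p.roots.map fun w => z - w).prod :=
    (IsAlgClosed.splits p).eval_eq_prod_roots z
  rw [h1, norm_mul, Real.log_mul (by simpa using hp0) (norm_ne_zero_iff.2 h3), ← h2]
  unfold logKernel
  rw [Multiset.sum_map_sub]
  ring

theorem cauchyTransform_empiricalMeasure {p : ℂ[X]} {z : ℂ}
    (hz : p.eval z ≠ 0) : cauchyTransform (empiricalMeasure p) z =
      (p.natDegree : ℂ)⁻¹ * ((derivative p).eval z / p.eval z) := by
  rw [cauchyTransform, integral_empiricalMeasure,
    (IsAlgClosed.splits p).eval_derivative_div_eval_of_ne_zero hz]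
  simp [one_div]

/-- The logarithm of |p'/(d p)| for d the degree: p' supplies d - 1 times its potential, p supplies
d times its own, and both hold off the finitely many zeros. -/
theorem exists_log_norm_cauchyTransform_empiricalMeasure {p : ℂ[X]} (hp : 2 ≤ p.natDegree) :
    ∃ C : ℝ, ∀ᵐ z, Real.log ‖cauchyTransform (empiricalMeasure p) z‖ =
      (p.natDegree - 1) * logPotential (empiricalMeasure (derivative p)) z -
        p.natDegree * logPotential (empiricalMeasure p) z + C := by
  have hd : (derivative p).natDegree = p.natDegree - 1 := natDegree_derivative p
  obtain ⟨A, hA⟩ := exists_logPotential_empiricalMeasure (p := p) (by omega)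
  obtain ⟨B, hB⟩ := exists_logPotential_empiricalMeasure (p := derivative p) (by omega)
  have hp0 : p ≠ 0 := by rintro rfl; simp at hp
  have hp1 : derivative p ≠ 0 := by
    intro h
    rw [h, natDegree_zero] at hd
    omega
  have hne (q : ℂ[X]) (hq : q ≠ 0) : ∀ᵐ z, q.eval z ≠ 0 := by
    have : {z | q.eval z = 0}.Finite := by
      refine (q.roots.toFinset.finite_toSet).subset fun z hz => ?_
      simpa [hq] using hz
    filter_upwards [this.countable.ae_notMem volume] with z hz using hz
  refine ⟨B - A - Real.log p.natDegree, ?_⟩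
  filter_upwards [hne p hp0, hne _ hp1] with z h0 h1
  have hB' := hB z h1
  rw [hd, Nat.cast_sub (by omega), Nat.cast_one] at hB'
  have hn : (p.natDegree : ℝ) ≠ 0 := by
    have : p.natDegree ≠ 0 := by omega
    exact_mod_cast this
  rw [hB', hA z h0, cauchyTransform_empiricalMeasure h0, norm_mul, norm_div, norm_inv,
    Complex.norm_natCast, Real.log_mul (inv_ne_zero hn)
    (div_ne_zero (norm_ne_zero_iff.2 h1) (norm_ne_zero_iff.2 h0)), Real.log_inv,
    Real.log_div (norm_ne_zero_iff.2 h1) (norm_ne_zero_iff.2 h0)]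
  ring

/-! ### Local constancy where the Cauchy transform vanishes. -/

theorem exists_square_mem_nhds {O : Set ℂ} {x : ℂ} (hO : O ∈ 𝓝 x) :
    ∃ a b a' b' : ℝ, a < b ∧ a' < b' ∧ Set.Icc a b ×ℂ Set.Icc a' b' ∈ 𝓝 x ∧
      Set.Icc a b ×ℂ Set.Icc a' b' ⊆ O := by
  obtain ⟨r, hr, hrO⟩ := Metric.mem_nhds_iff.1 hO
  refine ⟨x.re - r / 4, x.re + r / 4, x.im - r / 4, x.im + r / 4, by linarith, by linarith,
    ?_, fun z hz => hrO ?_⟩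
  · filter_upwards [Metric.ball_mem_nhds x (show 0 < r / 4 by positivity)] with z hz
    rw [Metric.mem_ball, dist_eq_norm] at hz
    have h1 := (Complex.abs_re_le_norm (z - x)).trans hz.le
    have h2 := (Complex.abs_im_le_norm (z - x)).trans hz.le
    rw [Complex.sub_re, abs_le] at h1
    rw [Complex.sub_im, abs_le] at h2
    exact Complex.mem_reProdIm.2 ⟨⟨by linarith, by linarith⟩, ⟨by linarith, by linarith⟩⟩
  · obtain ⟨h1, h2⟩ := Complex.mem_reProdIm.1 hz
    have h3 := Complex.norm_le_abs_re_add_abs_im (z - x)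
    have h4 : |(z - x).re| ≤ r / 4 := by
      rw [Complex.sub_re, abs_le]; constructor <;> linarith [h1.1, h1.2]
    have h5 : |(z - x).im| ≤ r / 4 := by
      rw [Complex.sub_im, abs_le]; constructor <;> linarith [h2.1, h2.2]
    rw [Metric.mem_ball, dist_eq_norm]
    linarith

theorem exists_logPotential_ae_eq_const {ν : Measure ℂ} [IsFiniteMeasure ν] {a b a' b' t : ℝ}
    (hab : a < b) (hab' : a' < b')
    (h0 : ∀ᵐ z, z ∈ Set.Icc a b ×ℂ Set.Icc a' b' → t < logPotential ν z →
      cauchyTransform ν z = 0)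
    (hpos : volume {z | z ∈ Set.Icc a b ×ℂ Set.Icc a' b' ∧ t < logPotential ν z} ≠ 0) :
    ∃ β, ∀ᵐ z, z ∈ Set.Icc a b ×ℂ Set.Icc a' b' → logPotential ν z = β := by
  obtain ⟨β, hβ⟩ := exists_ae_max_logPotential_eq (ν := ν) (τ := t) hab hab' h0
  -- Otherwise the potential would be at most `t` almost everywhere in the square, against `hpos`.
  -- Above `t` the truncation is inactive.
  have hβt : t < β := by
    by_contra! hle
    refine hpos (measure_mono_null (fun z hz => ?_) hβ)
    intro hcon
    have h1 := hcon hz.1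
    have h2 := le_max_left (logPotential ν z) t
    linarith [hz.2]
  refine ⟨β, ?_⟩
  filter_upwards [hβ] with z hz hzQ
  have h1 := hz hzQ
  rcases max_choice (logPotential ν z) t with h | h
  · rw [← h1, h]
  · rw [h] at h1
    exact absurd h1 hβt.ne

theorem notMem_support_of_cauchyTransform_eq_zero {ν : Measure ℂ} [IsFiniteMeasure ν] {x : ℂ}
    {t : ℝ} {O : Set ℂ} (hO : O ∈ 𝓝 x)
    (h0 : ∀ᵐ z, z ∈ O → t < logPotential ν z → cauchyTransform ν z = 0)
    (hpos : ∀ Q ∈ 𝓝 x, volume {z | z ∈ Q ∧ t < logPotential ν z} ≠ 0) : x ∉ ν.support := by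
  obtain ⟨a, b, a', b', hab, hab', hQ, hQO⟩ := exists_square_mem_nhds hO
  obtain ⟨β, hβ⟩ := exists_logPotential_ae_eq_const (ν := ν) (t := t) hab hab' (by
    filter_upwards [h0] with z hz hzQ using hz (hQO hzQ)) (hpos _ hQ)
  exact notMem_support_of_logPotential_ae_eq_const hQ hβ

/-- Replacing thresholds by rationals and neighbourhoods by a countable basis leaves countably many
null sets to discard. It serves as a substitute for approximate continuity. -/
theorem ae_forall_lt_volume_ne_zero (f : ℂ → ℝ) :
    ∀ᵐ x, ∀ t < f x, ∀ O ∈ 𝓝 x, volume {z | z ∈ O ∧ t < f z} ≠ 0 := by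
  set B := TopologicalSpace.countableBasis ℂ with hB
  have h : ∀ᵐ x, ∀ b ∈ B, ∀ q : ℚ, volume {z | z ∈ b ∧ (q : ℝ) < f z} = 0 →
      ¬(x ∈ b ∧ (q : ℝ) < f x) := by
    rw [ae_ball_iff (TopologicalSpace.countable_countableBasis ℂ)]
    intro b _
    rw [ae_all_iff]
    intro q
    by_cases hq : volume {z | z ∈ b ∧ (q : ℝ) < f z} = 0
    · filter_upwards [measure_eq_zero_iff_ae_notMem.1 hq] with x hx _ using hx
    · exact Eventually.of_forall fun x h => absurd h hq
  filter_upwards [h] with x hx t ht O hO h0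
  obtain ⟨b, hb, hxb, hbO⟩ :=
    (TopologicalSpace.isBasis_countableBasis ℂ).mem_nhds_iff.1 hO
  obtain ⟨q, hq1, hq2⟩ := exists_rat_btwn ht
  refine hx b hb q (measure_mono_null (fun z hz => ?_) h0) ⟨hxb, hq2⟩
  exact ⟨hbO hz.1, hq1.trans hz.2⟩

/-- A finite measure whose Cauchy transform vanishes almost everywhere is zero. -/
theorem eq_zero_of_cauchyTransform_ae_eq_zero {ν : Measure ℂ} [IsFiniteMeasure ν]
    (h : ∀ᵐ z, cauchyTransform ν z = 0) : ν = 0 := by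
  rw [← Measure.support_eq_empty_iff, Set.eq_empty_iff_forall_notMem]
  intro x
  obtain ⟨y, hy⟩ := (ae_forall_lt_volume_ne_zero (logPotential ν)).exists
  -- One square contains both `x` and `y`: positive measure is known near `y`, and the resulting
  -- constancy is used near `x`.
  set M := ‖x‖ + ‖y‖ + 1
  have hM : 0 < M := by positivity
  have hsub : Metric.ball 0 M ⊆ Set.Icc (-M) M ×ℂ Set.Icc (-M) M := fun z hz => by
    have hz' : ‖z‖ ≤ M := by simpa using (Metric.mem_ball.1 hz).le
    exact Complex.mem_reProdIm.2 ⟨abs_le.1 ((Complex.abs_re_le_norm z).trans hz'),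
      abs_le.1 ((Complex.abs_im_le_norm z).trans hz')⟩
  have hmem (z : ℂ) (hz : ‖z‖ < M) : Set.Icc (-M) M ×ℂ Set.Icc (-M) M ∈ 𝓝 z :=
    mem_of_superset (Metric.isOpen_ball.mem_nhds (by simpa using hz)) hsub
  obtain ⟨β, hβ⟩ := exists_logPotential_ae_eq_const (ν := ν) (t := logPotential ν y - 1)
    (by linarith : -M < M) (by linarith : -M < M) (by
      filter_upwards [h] with z hz _ _ using hz)
    (hy _ (sub_one_lt _) _ (hmem y (by linarith [norm_nonneg x])))
  exact notMem_support_of_logPotential_ae_eq_const (hmem x (by linarith [norm_nonneg y])) hβ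

/-! ### Comparison of the two limits, and the theorem. -/

/-- The limits of two sequences of measures agree if the potentials of the sequences differ, up to
constants, by a vanishing multiple of the logarithm of the Cauchy transform. -/
theorem eq_of_log_norm_cauchyTransform {μ μ' : Measure ℂ} (hμ : μ Set.univ ≤ 1)
    (hμ' : μ' Set.univ ≤ 1) (hμ0 : μ ≠ 0) (hcompl : NoBoundedComponent μ.supportᶜ)
    {ν ν' : ℕ → Measure ℂ} (hν : ∀ n, ν n Set.univ ≤ 1) (hν' : ∀ n, ν' n Set.univ ≤ 1)
    (hlim : VagueTendsto ν μ) (hlim' : VagueTendsto ν' μ')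
    {N C : ℕ → ℝ} (hN : Tendsto N atTop atTop)
    (hlog : ∀ n, ∀ᵐ z, Real.log ‖cauchyTransform (ν n) z‖ =
      (N n - 1) * logPotential (ν' n) z - N n * logPotential (ν n) z + C n) : μ' = μ := by
  have hfin := isFiniteMeasure_of_univ_le_one hμ
  have hfin' := isFiniteMeasure_of_univ_le_one hμ'
  obtain ⟨m, hm, hmv, hvm⟩ := exists_finite_measure_le_volume
  obtain ⟨φ₁, hφ₁, h1⟩ := (tendstoInMeasure_logPotential hlim hν hμ hmv).exists_seq_tendsto_ae
  obtain ⟨φ₂, hφ₂, h2⟩ := (tendstoInMeasure_logPotential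
    (hlim'.comp_tendsto hφ₁.tendsto_atTop) (fun _ => hν' _) hμ' hmv).exists_seq_tendsto_ae
  obtain ⟨φ₃, hφ₃, h3⟩ := (tendstoInMeasure_cauchyTransform
    (hlim.comp_tendsto (hφ₁.comp hφ₂).tendsto_atTop) (fun _ => hν _) hμ
    hmv).exists_seq_tendsto_ae
  set φ : ℕ → ℕ := fun n => φ₁ (φ₂ (φ₃ n)) with hφdef
  have hφ : Tendsto φ atTop atTop := (hφ₁.comp (hφ₂.comp hφ₃)).tendsto_atTop
  have hNφ : Tendsto (fun n => N (φ n)) atTop atTop := hN.comp hφ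
  have hNinv : Tendsto (fun n => (N (φ n))⁻¹) atTop (𝓝 0) := hNφ.inv_tendsto_atTop
  have hgood : ∀ᵐ z, Tendsto (fun n => logPotential (ν (φ n)) z) atTop (𝓝 (logPotential μ z)) ∧
      Tendsto (fun n => logPotential (ν' (φ n)) z) atTop (𝓝 (logPotential μ' z)) ∧
      Tendsto (fun n => cauchyTransform (ν (φ n)) z) atTop (𝓝 (cauchyTransform μ z)) ∧
      ∀ n, Real.log ‖cauchyTransform (ν n) z‖ =
        (N n - 1) * logPotential (ν' n) z - N n * logPotential (ν n) z + C n := by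
    filter_upwards [hvm.ae_le h1, hvm.ae_le h2, hvm.ae_le h3, ae_all_iff.2 hlog] with z e1 e2 e3 e4
    exact ⟨e1.comp (hφ₂.comp hφ₃).tendsto_atTop, e2.comp hφ₃.tendsto_atTop, e3, e4⟩
  have hquot : ∀ᵐ z, Tendsto (fun n => (N (φ n))⁻¹ * Real.log ‖cauchyTransform (ν (φ n)) z‖ -
      (N (φ n))⁻¹ * C (φ n)) atTop (𝓝 (logPotential μ' z - logPotential μ z)) := by
    filter_upwards [hgood] with z hz
    obtain ⟨e1, e2, -, e4⟩ := hz
    have e5 : Tendsto (fun n => (1 - (N (φ n))⁻¹) * logPotential (ν' (φ n)) z -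
        logPotential (ν (φ n)) z) atTop (𝓝 ((1 - 0) * logPotential μ' z - logPotential μ z)) :=
      ((hNinv.const_sub 1).mul e2).sub e1
    rw [sub_zero, one_mul] at e5
    refine e5.congr' ?_
    filter_upwards [hNφ.eventually_gt_atTop 0] with n hn
    rw [e4]
    field_simp
    ring
  have hzero : ∀ᵐ z, cauchyTransform μ z ≠ 0 →
      Tendsto (fun n => (N (φ n))⁻¹ * Real.log ‖cauchyTransform (ν (φ n)) z‖) atTop (𝓝 0) := by
    filter_upwards [hgood] with z hg hz
    obtain ⟨-, -, e3, -⟩ := hg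
    have e5 := hNinv.mul (e3.norm.log (norm_ne_zero_iff.2 hz))
    rwa [zero_mul] at e5
  -- At a typical point where the Cauchy transform of μ is nonzero the logarithmic term tends to 0,
  -- forcing the normalised constants to converge. Such points exist because μ ≠ 0.
  obtain ⟨c, hc⟩ : ∃ c, Tendsto (fun n => (N (φ n))⁻¹ * C (φ n)) atTop (𝓝 c) := by
    by_contra hcon
    have hL : ∀ᵐ z, cauchyTransform μ z = 0 := by
      filter_upwards [hquot, hzero] with z e1 e2
      by_contra hz
      refine hcon ⟨_, ((e2 hz).sub e1).congr fun n => ?_⟩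
      ring
    exact hμ0 (eq_zero_of_cauchyTransform_ae_eq_zero hL)
  have hle : ∀ᵐ z, logPotential μ' z + c ≤ logPotential μ z := by
    filter_upwards [hquot, hgood] with z e1 hg
    obtain ⟨-, -, e3, -⟩ := hg
    have e4 : Tendsto (fun n => (N (φ n))⁻¹ * Real.log ‖cauchyTransform (ν (φ n)) z‖) atTop
        (𝓝 (logPotential μ' z - logPotential μ z + c)) :=
      (e1.add hc).congr fun n => by ring
    have e5 := hNinv.mul e3.norm
    rw [zero_mul] at e5
    -- The bound log x ≤ x gives the inequality everywhere, including where the limiting Cauchy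
    -- transform vanishes and the logarithm may tend to -∞.
    have e6 := le_of_tendsto_of_tendsto e4 e5 (by
      filter_upwards [hNφ.eventually_gt_atTop 0] with n hn
      exact mul_le_mul_of_nonneg_left (Real.log_le_self (norm_nonneg _)) (by positivity))
    linarith
  have heq : ∀ᵐ z, cauchyTransform μ z ≠ 0 → logPotential μ z = logPotential μ' z + c := by
    filter_upwards [hquot, hzero] with z e1 e2 hz
    have e3 := tendsto_nhds_unique ((e2 hz).sub hc) e1
    linarith
  have hge : ∀ᵐ z, logPotential μ z ≤ logPotential μ' z + c := by
    filter_upwards [ae_cauchyTransform_ne_zero hμ0 hcompl, heq, ae_singPotential_lt_top μ',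
      ae_forall_lt_volume_ne_zero (logPotential μ)] with x e1 e2 e3 e4
    by_contra! hlt
    obtain ⟨t, ht1, ht2⟩ := exists_between hlt
    -- Near `x` the potential of μ' plus `c` is below `t`, so wherever that of μ exceeds `t`
    -- equality fails and its Cauchy transform vanishes: `x` is off the support. It must also lie in
    -- the support, since off it the transform is nonzero at `x` and `heq` contradicts `hlt`.
    refine (notMem_support_of_cauchyTransform_eq_zero (t := t)
      (eventually_logPotential_lt e3 (t := t - c) (by linarith)) ?_
      (e4 t ht2) : x ∉ μ.support) ?_
    · filter_upwards [heq, ae_singPotential_lt_top μ'] with z f1 f2 f3 f4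
      by_contra hz
      have f5 := f3 f2
      linarith [f1 hz]
    · by_contra hxs
      linarith [e2 (e1 hxs)]
  refine (measure_ext_of_integral_contDiff hμ hμ' fun ψ hψ hψs => ?_).symm
  refine integral_eq_of_logPotential_ae_eq (c := c) hψ hψs ?_
  filter_upwards [hle, hge] with z e1 e2 _ using le_antisymm e2 e1

theorem VagueTendsto.empiricalMeasure_derivative {P : ℕ → ℂ[X]}
    (hP : ∀ n : ℕ, 1 ≤ n → (P n).degree = (n : WithBot ℕ)) {μ : Measure ℂ}
    [IsLocallyFiniteMeasure μ] (hcompl : NoBoundedComponent μ.supportᶜ) (hμ : μ ≠ 0)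
    (h : VagueTendsto (fun n => empiricalMeasure (P n)) μ) :
    VagueTendsto (fun n => empiricalMeasure (derivative (P n))) μ := by
  have hμ1 : μ Set.univ ≤ 1 := h.univ_le_one fun n => empiricalMeasure_univ_le_one _
  intro f hf hfc
  refine tendsto_of_subseq_tendsto fun ns hns => ?_
  -- From index 2 on the derivative has positive degree, so its empirical measure is a probability
  -- measure and compactness applies.
  obtain ⟨k, hk⟩ := eventually_atTop.1 (hns.eventually_ge_atTop 2)
  set ms : ℕ → ℕ := fun j => ns (j + k) with hms
  have hmst : Tendsto ms atTop atTop := hns.comp (tendsto_add_atTop_nat k)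
  have hms2 : ∀ j, 2 ≤ ms j := fun j => hk _ (Nat.le_add_left _ _)
  have hdeg : ∀ j, (P (ms j)).natDegree = ms j := fun j =>
    natDegree_eq_of_degree_eq_some (hP _ (by have := hms2 j; omega))
  have hprob : ∀ j, IsProbabilityMeasure (empiricalMeasure (derivative (P (ms j)))) := fun j =>
    ⟨empiricalMeasure_univ (by
      rw [natDegree_derivative, hdeg]
      have := hms2 j
      omega)⟩
  obtain ⟨φ, μ', hφ, hμ'1, hφlim⟩ :=
    exists_subseq_vagueTendsto fun j => empiricalMeasure (derivative (P (ms j)))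
  choose C hC using fun j => exists_log_norm_cauchyTransform_empiricalMeasure
    (p := P (ms j)) (by rw [hdeg]; exact hms2 j)
  have hμ' : μ' = μ := eq_of_log_norm_cauchyTransform hμ1 hμ'1 hμ hcompl
    (fun n => empiricalMeasure_univ_le_one (P (ms (φ n))))
    (fun n => empiricalMeasure_univ_le_one _)
    (h.comp_tendsto (hmst.comp hφ.tendsto_atTop)) hφlim (C := fun n => C (φ n))
    (N := fun n => ((P (ms (φ n))).natDegree : ℝ))
    (by
      simp_rw [hdeg]
      exact tendsto_natCast_atTop_atTop.comp (hmst.comp hφ.tendsto_atTop))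
    (fun n => hC (φ n))
  refine ⟨fun n => φ n + k, ?_⟩
  rw [← hμ']
  exact hφlim f hf hfc

theorem mainTheorem6 (P : ℕ → ℂ[X]) (hP : ∀ n : ℕ, 1 ≤ n → (P n).degree = (n : WithBot ℕ))
    (μ : Measure ℂ) [IsLocallyFiniteMeasure μ]
    (hcompl : NoBoundedComponent (μ.support)ᶜ) :
    (μ ≠ 0 →
      VagueTendsto (fun n => empiricalMeasure (P n)) μ →
      VagueTendsto (fun n => empiricalMeasure (derivative (P n))) μ) ∧
    (WeakTendsto (fun n => empiricalMeasure (P n)) μ →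
      WeakTendsto (fun n => empiricalMeasure (derivative (P n))) μ) := by
  refine ⟨fun hμ h => h.empiricalMeasure_derivative hP hcompl hμ, fun h => ?_⟩
  have hvague : VagueTendsto (fun n => empiricalMeasure (P n)) μ := fun f hf hfc => by
    obtain ⟨B, hB⟩ := hfc.exists_bound_of_continuous hf
    exact h (BoundedContinuousFunction.ofNormedAddCommGroup f hf B hB)
  -- Testing against the constant 1 shows that no mass is lost, so the vague limit of the critical
  -- measures upgrades to a weak one.
  have hμ1 : μ Set.univ = 1 := by
    have h1 := h (BoundedContinuousFunction.const ℂ 1)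
    simp only [BoundedContinuousFunction.const_apply, integral_const, smul_eq_mul, mul_one] at h1
    have h2 : Tendsto (fun n => (empiricalMeasure (P n)).real Set.univ) atTop (𝓝 1) := by
      refine tendsto_const_nhds.congr' ?_
      filter_upwards [eventually_ge_atTop 1] with n hn
      rw [measureReal_def, empiricalMeasure_univ, ENNReal.toReal_one]
      rw [natDegree_eq_of_degree_eq_some (hP n hn)]
      omega
    have h3 := tendsto_nhds_unique h1 h2
    rw [measureReal_def] at h3
    exact (ENNReal.toReal_eq_one_iff _).1 h3
  have hμ0 : μ ≠ 0 := by rintro rfl; simp at hμ1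
  exact (hvague.empiricalMeasure_derivative hP hcompl hμ0).weakTendsto
    (fun n => empiricalMeasure_univ_le_one _) hμ1
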